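/- Let $(M,\mu)$ and $(N,\nu)$ be arbitrary measure spaces, let $1\le q<p\le\infty$, $\alpha=\frac1q-\frac1p$, $C(p,q)=(1-\frac qp)^{1/q}$ (with $\frac1\infty=\frac q\infty=0$), and let $t>0$. For a Bochner measurable function $f$ on $(M,\mu)$ with values in a Banach space let $\|f\|_{L^{p,\infty}(d\mu)}=\inf\{C\ge 0: s^p\mu\{\|f\|>s\}\le C^p\text{ for all }s>0\}$ if $p<\infty$, and $\|f\|_{L^{\infty,\infty}(d\mu)}=\operatorname{ess\,sup}\|f\|$. Let $$A_0=L^{p,\infty}(d\mu;L^q(d\nu)),\qquad A_1=L^{p,\infty}(d\nu;L^q(d\mu))$$ in Bochner's sense. Elements of $A_0$ and $A_1$ are represented by jointly measurable scalar (real or complex) functions on $M\times N$; two functions on $M\times N$ are identified if they agree a.e. on every measurable rectangle $E\times F$ with $\mu(E),\nu(F)<\infty$ (for $\sigma$-finite measures: if they agree $\mu\times\nu$-a.e.). Put $$K_{p,q,t}(a)=\inf\{\|b\|_{A_0}+t\,\|c\|_{A_1}: a=b+c,\ b\in A_0,\ c\in A_1\}$$ (with $\inf\emptyset=\infty$) and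 $$|||a|||_{p,q,t}=\sup_{E,F}\bigl(\mu(E)^\alpha\vee t^{-1}\nu(F)^\alpha\bigr)^{-1}\|1_{E\times F}\,a\|_{L^q(\mu\times\nu)},$$ the supremum running over all measurable $E\subset M$, $F\subset N$ of positive and finite measure (with $\sup\emptyset=0$). Then $$C(p,q)\,|||a|||_{p,q,t}\le K_{p,q,t}(a)\le 2\,|||a|||_{p,q,t}$$ for every $a\in A_0+A_1$. If $\mu$ and $\nu$ are $\sigma$-finite (in particular for Lebesgue measure on $\mathbb R$), these inequalities hold in $[0,\infty]$ for every $\mu\times\nu$-measurable scalar function $a$ on $M\times N$; in particular $a\in A_0+A_1$ as soon as $|||a|||_{p,q,t}<\infty$. -/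

import Mathlib

open MeasureTheory
open scoped ENNReal NNReal

namespace WeakMixed

noncomputable section

/-- The weak `L^p` functional `‖f‖_{L^{p,∞}(μ; X)}` of a function with values in a normed space:
the infimum of all `C` with `s ^ p * μ {‖f‖ > s} ≤ C ^ p` for all `s > 0`. For `p = ∞` it is the
essential supremum of `‖f‖`. -/
def weakLpNorm {M X : Type*} [MeasurableSpace M] [NormedAddCommGroup X]
    (f : M → X) (p : ℝ≥0∞) (μ : Measure M) : ℝ≥0∞ :=
  if p = ∞ then eLpNorm f ∞ μ
  else sInf {C : ℝ≥0∞ | ∀ s : ℝ, 0 < s →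
    ENNReal.ofReal s ^ p.toReal * μ {x | s < ‖f x‖} ≤ C ^ p.toReal}

variable {M N 𝕜 : Type*} [MeasurableSpace M] [MeasurableSpace N] [RCLike 𝕜]

/-- The jointly measurable function `b` on `M × N` is a kernel of the `L^q(ν)`-valued function `f`
on `M`: for almost every `x`, the element `f x` of `L^q(ν)` is the class of `b (x, ·)`. -/
def IsKernel (μ : Measure M) (ν : Measure N) (q : ℝ≥0∞)
    (f : M → Lp 𝕜 q ν) (b : M × N → 𝕜) : Prop :=
  StronglyMeasurable b ∧ ∀ᵐ x ∂μ, f x =ᵐ[ν] fun y => b (x, y)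

/-- The functional `‖b‖_{L^{p,∞}(μ; L^q(ν))}` of a scalar function `b` on `M × N`, in Bochner's
sense: it is the weak `L^p` functional of the Bochner measurable function `x ↦ b (x, ·) ∈ L^q(ν)`
(which is unique up to null sets), and `∞` if `b` is not the kernel of a Bochner measurable
`L^q(ν)`-valued function. -/
def mixedNorm (p q : ℝ≥0∞) [Fact (1 ≤ q)] (μ : Measure M) (ν : Measure N)
    (b : M × N → 𝕜) : ℝ≥0∞ :=
  ⨅ (f : M → Lp 𝕜 q ν) (_ : AEStronglyMeasurable f μ) (_ : IsKernel μ ν q f b),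
    weakLpNorm f p μ

/-- Two functions on `M × N` are identified if they agree almost everywhere on every measurable
rectangle `E × F` whose sides have finite measure. (If `μ` and `ν` are σ-finite, this is equality
almost everywhere for the product measure.) -/
def LocallyAEEq (μ : Measure M) (ν : Measure N) (a a' : M × N → 𝕜) : Prop :=
  ∀ (E : Set M) (F : Set N), MeasurableSet E → MeasurableSet F → μ E < ∞ → ν F < ∞ →
    a =ᵐ[(μ.restrict E).prod (ν.restrict F)] a'

/-- `a` belongs to `L^{p,∞}(μ; L^q(ν)) + L^{p,∞}(ν; L^q(μ))`. -/
def MemSum (p q : ℝ≥0∞) [Fact (1 ≤ q)] (μ : Measure M) (ν : Measure N)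
    (a : M × N → 𝕜) : Prop :=
  ∃ b c : M × N → 𝕜, LocallyAEEq μ ν a (b + c) ∧
    mixedNorm p q μ ν b < ∞ ∧ mixedNorm p q ν μ (c ∘ Prod.swap) < ∞

/-- The `K_t`-functional of the couple `L^{p,∞}(μ; L^q(ν))`, `L^{p,∞}(ν; L^q(μ))`: the infimum of
`‖b‖ + t ‖c‖` over all decompositions `a = b + c`. It is `∞` outside the sum of the couple. -/
def kFunctional (p q : ℝ≥0∞) [Fact (1 ≤ q)] (μ : Measure M) (ν : Measure N) (t : ℝ≥0)
    (a : M × N → 𝕜) : ℝ≥0∞ :=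
  ⨅ (b : M × N → 𝕜) (c : M × N → 𝕜) (_ : LocallyAEEq μ ν a (b + c)),
    mixedNorm p q μ ν b + (t : ℝ≥0∞) * mixedNorm p q ν μ (c ∘ Prod.swap)

/-- The exponent `α = 1/q - 1/p` (with `1/∞ = 0`). -/
def alpha (p q : ℝ≥0∞) : ℝ := q.toReal⁻¹ - p.toReal⁻¹

/-- The constant `C(p,q) = (1 - q/p) ^ (1/q)` (with `q/∞ = 0`). -/
def lowerConst (p q : ℝ≥0∞) : ℝ≥0∞ := (1 - q / p) ^ q.toReal⁻¹

/-- The supremum of `(μ(E)^α ∨ t⁻¹ ν(F)^α)⁻¹ ‖1_{E×F} a‖_{L^q}` over all measurable `E`, `F` of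
positive and finite measure. -/
def rectNorm (p q : ℝ≥0∞) (μ : Measure M) (ν : Measure N) (t : ℝ≥0)
    (a : M × N → 𝕜) : ℝ≥0∞ :=
  ⨆ (E : Set M) (F : Set N) (_ : MeasurableSet E) (_ : MeasurableSet F)
    (_ : 0 < μ E) (_ : μ E < ∞) (_ : 0 < ν F) (_ : ν F < ∞),
    (max (μ E ^ alpha p q) ((t : ℝ≥0∞)⁻¹ * ν F ^ alpha p q))⁻¹ *
      eLpNorm a q ((μ.restrict E).prod (ν.restrict F))

end

end WeakMixed

/-! Put `β = q α = 1 - q/p ∈ (0, 1]` and let `R` be the rectangle norm of `a`.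

Lower bound. By the layer-cake formula, the integral of `‖f‖ ^ q` over `E` is at most `β⁻¹ ‖f‖ ^ q
μ(E) ^ β` for `f` in weak `L^p`, and this is where `C(p,q) = β ^ (1/q)` comes from. Applied to both
terms of a decomposition, it bounds `1_{E×F} a` by the triangle inequality
(`lowerConst_mul_rectNorm_le`).

Upper bound, σ-finite case. The measure `W = |a| ^ q d(μ×ν)` satisfies `W(E×F) ≤ R^q μ(E)^β +
(R/t)^q ν(F)^β`. Since `s ↦ s^β` is concave, both terms are submodular in their sets. For finite
matrices, a sandwich argument then splits `W` into one part controlled by the rows and one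
controlled by the columns (`exists_split_of_submodular`). Compactness passes from finite partitions
to arbitrary measurable sets; the limits are a priori only finitely additive, but domination by `W`
makes them countably additive (`exists_split_of_rect_le`). With `θ = dW₁/dW`, take `b = θ a` and `c
= (1 - θ) a`. As `q ≥ 1`, `|b|^q ≤ θ |a|^q`, and likewise for `c`. Testing on level sets gives weak
norms at most `R` and `R/t`, so the total cost is `R + t (R/t) = 2R`.

Upper bound in general. Given `a = b₀ + c₀` in the sum, Bochner measurability puts `b₀` on a strip
`M × N₀` and `c₀` on a strip `M₀ × N`, with `N₀`, `M₀` σ-finite. The σ-finite result is used on a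
larger σ-finite rectangle `M₁ × N₁`; outside it `b₀` and `c₀` are kept. For `p < ∞` the relevant
tails vanish. For `p = ∞` the rectangle norm bounds their sections off suitable sets that meet every
set of finite measure in a null set (`exists_sigmaFinite_tail`), so gluing does not increase the
constants. -/

namespace WeakMixed

/-! ### Finite combinatorics: splitting a matrix between submodular capacities. -/

section

/-- Splitting a nonnegative matrix between two submodular capacities of rows and columns. -/
theorem exists_split_of_submodular {I J : Type*} [Fintype I] [Fintype J] [DecidableEq I]
    [DecidableEq J] (P : Finset (I × J)) :
    ∀ (f : Finset I → ℝ) (g : Finset J → ℝ) (w : I × J → ℝ)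
    (_ : ∀ S S', f (S ∪ S') + f (S ∩ S') ≤ f S + f S')
    (_ : ∀ T T', g (T ∪ T') + g (T ∩ T') ≤ g T + g T')
    (_ : f ∅ = 0) (_ : g ∅ = 0) (_ : ∀ x, 0 ≤ w x) (_ : ∀ x, x ∉ P → w x = 0)
    (_ : ∀ S T, ∑ x ∈ S ×ˢ T, w x ≤ f S + g T),
    ∃ u : I × J → ℝ, (∀ x, 0 ≤ u x ∧ u x ≤ w x) ∧
      (∀ S, ∑ x ∈ S ×ˢ Finset.univ, u x ≤ f S) ∧
      (∀ T, ∑ x ∈ Finset.univ ×ˢ T, (w x - u x) ≤ g T) := by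
  induction P using Finset.induction_on with
  | empty =>
    intro f g w hf hg hf0 hg0 hw hP h
    have hw0 : w = 0 := funext fun x => hP x (by simp)
    subst hw0
    refine ⟨0, by simp, fun S => ?_, fun T => ?_⟩
    · simpa [hg0] using h S ∅
    · simpa [hf0] using h ∅ T
  | insert z P hz ih =>
    intro f g w hf hg hf0 hg0 hw hP h
    obtain ⟨i, j⟩ := z
    -- Uncrossing: `(i, j)` lies in neither rectangle but does lie in `(S ∪ S') ×ˢ (T ∪ T')`. Hence
    -- the hypothesis for unions and intersections, with submodularity, leaves room for one extra
    -- copy of `w (i, j)`.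
    have super : ∀ S T S' T', i ∈ S → j ∉ T → i ∉ S' → j ∈ T' →
        w (i, j) + ∑ x ∈ S ×ˢ T, w x + ∑ x ∈ S' ×ˢ T', w x ≤
          f S + g T + (f S' + g T') := by
      intro S T S' T' h1 h2 h3 h4
      have e1 := Finset.sum_union_inter (s₁ := S ×ˢ T) (s₂ := S' ×ˢ T') (f := w)
      rw [Finset.product_inter_product] at e1
      have e2 : ∑ x ∈ insert (i, j) (S ×ˢ T ∪ S' ×ˢ T'), w x ≤
          ∑ x ∈ (S ∪ S') ×ˢ (T ∪ T'), w x := by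
        refine Finset.sum_le_sum_of_subset_of_nonneg ?_ fun x _ _ => hw x
        intro x
        simp only [Finset.mem_insert, Finset.mem_union, Finset.mem_product]
        rintro (rfl | hx | hx)
        · exact ⟨Or.inl h1, Or.inr h4⟩
        · exact ⟨Or.inl hx.1, Or.inl hx.2⟩
        · exact ⟨Or.inr hx.1, Or.inr hx.2⟩
      rw [Finset.sum_insert (by simp [h2, h3])] at e2
      have e3 := h (S ∪ S') (T ∪ T')
      have e4 := h (S ∩ S') (T ∩ T')
      have e5 := hf S S'
      have e6 := hg T T'
      linarith
    -- The share `u` of the entry `(i, j)` is charged to row `i` and the rest to column `j`.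
    -- Rectangles meeting only the column bound `u` from below, those meeting only the row bound it
    -- from above; `super` says that these bounds are compatible.
    let lo : Set ℝ := {y | y = 0 ∨ ∃ S T, i ∉ S ∧ j ∈ T ∧
      y = w (i, j) - (f S + g T - ∑ x ∈ S ×ˢ T, w x)}
    let hi : Set ℝ := {y | y = w (i, j) ∨ ∃ S T, i ∈ S ∧ j ∉ T ∧
      y = f S + g T - ∑ x ∈ S ×ˢ T, w x}
    obtain ⟨u, hlo, hhi⟩ : (upperBounds lo ∩ lowerBounds hi).Nonempty := by
      refine exists_between_of_forall_le ⟨0, Or.inl rfl⟩ ⟨w (i, j), Or.inl rfl⟩ ?_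
      rintro y (rfl | ⟨S', T', h3, h4, rfl⟩) y' (rfl | ⟨S, T, h1, h2, rfl⟩)
      · exact hw _
      · linarith [h S T]
      · linarith [h S' T']
      · linarith [super S T S' T' h1 h2 h3 h4]
    have hu0 : 0 ≤ u := hlo (Or.inl rfl)
    have huw : u ≤ w (i, j) := hhi (Or.inl rfl)
    have hsumw : ∀ S T, ∑ x ∈ S ×ˢ T, (w x - if x = (i, j) then w (i, j) else 0) =
        ∑ x ∈ S ×ˢ T, w x - if i ∈ S ∧ j ∈ T then w (i, j) else 0 := by
      intro S T
      rw [Finset.sum_sub_distrib, Finset.sum_ite_eq']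
      simp only [Finset.mem_product]
    -- Delete the entry and subtract the amounts charged from the capacities. The corrections are
    -- modular, so submodularity survives.
    obtain ⟨v, hv, hvS, hvT⟩ := ih (fun S => f S - if i ∈ S then u else 0)
      (fun T => g T - if j ∈ T then w (i, j) - u else 0)
      (fun x => w x - if x = (i, j) then w (i, j) else 0)
      (by
        intro S S'
        have := hf S S'
        by_cases a : i ∈ S <;> by_cases b : i ∈ S' <;> simp [a, b] <;> linarith)
      (by
        intro S S'
        have := hg S S'
        by_cases a : j ∈ S <;> by_cases b : j ∈ S' <;> simp [a, b] <;> linarith)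
      (by simpa using hf0) (by simpa using hg0)
      (by
        intro x
        by_cases hx : x = (i, j)
        · simp [hx]
        · simpa [hx] using hw x)
      (by
        intro x hx
        by_cases hxz : x = (i, j)
        · simp [hxz]
        · simpa [hxz] using hP x (by simp [hxz, hx]))
      (by
        intro S T
        simp only [hsumw]
        by_cases a : i ∈ S <;> by_cases b : j ∈ T
        · simp only [a, b, and_self, if_true]
          linarith [h S T]
        · have : u ≤ f S + g T - ∑ x ∈ S ×ˢ T, w x := hhi (Or.inr ⟨S, T, a, b, rfl⟩)
          simp only [a, b, if_true, if_false, and_false]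
          linarith
        · have : w (i, j) - (f S + g T - ∑ x ∈ S ×ˢ T, w x) ≤ u :=
            hlo (Or.inr ⟨S, T, a, b, rfl⟩)
          simp only [a, b, if_true, if_false, false_and]
          linarith
        · simp only [a, b, if_false, false_and]
          linarith [h S T])
    have hsumv : ∀ S, ∑ x ∈ S ×ˢ (Finset.univ : Finset J), (if x = (i, j) then u else 0) =
        if i ∈ S then u else 0 := by
      intro S
      rw [Finset.sum_ite_eq']
      simp
    have hsumv' : ∀ (c : ℝ) T, ∑ x ∈ (Finset.univ : Finset I) ×ˢ T,
        (if x = (i, j) then c else 0) = if j ∈ T then c else 0 := by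
      intro c T
      rw [Finset.sum_ite_eq']
      simp
    refine ⟨fun x => v x + if x = (i, j) then u else 0, fun x => ?_, fun S => ?_, fun T => ?_⟩
    · have := hv x
      by_cases hx : x = (i, j)
      · subst hx
        simp only [if_true, sub_self] at this ⊢
        constructor <;> linarith
      · simpa [hx] using this
    · rw [Finset.sum_add_distrib, hsumv]
      linarith [hvS S]
    · have := hvT T
      have e : ∀ x, w x - (v x + if x = (i, j) then u else 0) =
          (w x - (if x = (i, j) then w (i, j) else 0) - v x) +
            if x = (i, j) then w (i, j) - u else 0 := by
        intro x
        by_cases hx : x = (i, j)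
        · subst hx; simp only [if_true]; ring
        · simp [hx]
      simp only [e]
      rw [Finset.sum_add_distrib, hsumv']
      linarith

/-- A concave power is submodular along nonnegative increments. -/
theorem rpow_add_add_rpow_le {β : ℝ} (h0 : 0 ≤ β) (h1 : β ≤ 1) {x a b : ℝ} (hx : 0 ≤ x)
    (ha : 0 ≤ a) (hb : 0 ≤ b) :
    (x + a + b) ^ β + x ^ β ≤ (x + a) ^ β + (x + b) ^ β := by
  rcases eq_or_lt_of_le (add_nonneg ha hb) with hab | hab
  · have : a = 0 := by linarith
    have : b = 0 := by linarith
    subst_vars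
    simp
  have hc := Real.concaveOn_rpow h0 h1
  have hxm : x ∈ Set.Ici (0 : ℝ) := hx
  have hym : x + a + b ∈ Set.Ici (0 : ℝ) := by simp only [Set.mem_Ici]; positivity
  have e1 := hc.2 hxm hym (show 0 ≤ b / (a + b) by positivity)
    (show 0 ≤ a / (a + b) by positivity)
    (by field_simp; ring)
  have e2 := hc.2 hxm hym (show 0 ≤ a / (a + b) by positivity)
    (show 0 ≤ b / (a + b) by positivity)
    (by field_simp)
  simp only [smul_eq_mul] at e1 e2
  have i1 : b / (a + b) * x + a / (a + b) * (x + a + b) = x + a := by field_simp; ring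
  have i2 : a / (a + b) * x + b / (a + b) * (x + a + b) = x + b := by field_simp; ring
  rw [i1] at e1
  rw [i2] at e2
  have i3 : ∀ X Y : ℝ, b / (a + b) * X + a / (a + b) * Y + (a / (a + b) * X + b / (a + b) * Y)
      = X + Y := by intro X Y; field_simp; ring
  have := i3 (x ^ β) ((x + a + b) ^ β)
  linarith

end

/-! ### Splitting a measure on a product between its two marginal constraints. -/

section

/-- An additive set function dominated by a finite measure is a measure. -/
theorem exists_measure_of_le {Ω : Type*} [MeasurableSpace Ω] (W : Measure Ω) [IsFiniteMeasure W]
    (m : Set Ω → ℝ≥0∞)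
    (hadd : ∀ s t, MeasurableSet s → MeasurableSet t → Disjoint s t → m (s ∪ t) = m s + m t)
    (hle : ∀ s, MeasurableSet s → m s ≤ W s) :
    ∃ V : Measure Ω, ∀ s, MeasurableSet s → V s = m s := by
  have h0 : m ∅ = 0 := by simpa using hle ∅ .empty
  refine ⟨Measure.ofMeasurable (fun s _ => m s) h0 ?_, fun s hs => Measure.ofMeasurable_apply s hs⟩
  intro f hf hd
  -- Finite additivity leaves a tail term, which tends to `0` because the finite measure `W`
  -- dominates it.
  have key : ∀ n, m (⋃ k, f k) = ∑ i ∈ Finset.range n, m (f i) + m (⋃ k, f (k + n)) := by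
    intro n
    induction n with
    | zero => simp
    | succ n ih =>
      have e : (⋃ k, f (k + n)) = f n ∪ ⋃ k, f (k + (n + 1)) := by
        ext x
        simp only [Set.mem_iUnion, Set.mem_union]
        constructor
        · rintro ⟨k, hk⟩
          rcases k with _ | k
          · left; simpa using hk
          · right; exact ⟨k, by rwa [show k + (n + 1) = k + 1 + n by ring]⟩
        · rintro (h | ⟨k, hk⟩)
          · exact ⟨0, by simpa using h⟩
          · exact ⟨k + 1, by rwa [show k + 1 + n = k + (n + 1) by ring]⟩
      rw [ih, e, hadd _ _ (hf n) (.iUnion fun k => hf _), Finset.sum_range_succ, add_assoc]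
      rw [Set.disjoint_iUnion_right]
      intro k
      exact hd (by omega)
  have hW : Filter.Tendsto (fun n => W (⋃ k, f (k + n))) Filter.atTop (nhds 0) := by
    have e : ∀ n, W (⋃ k, f (k + n)) = ∑' k, W (f (k + n)) := fun n =>
      measure_iUnion (fun i j hij => hd (by omega)) fun k => hf _
    simp only [e]
    refine ENNReal.tendsto_sum_nat_add (fun k => W (f k)) ?_
    rw [← measure_iUnion hd hf]
    exact measure_ne_top _ _
  have hm : Filter.Tendsto (fun n => m (⋃ k, f (k + n))) Filter.atTop (nhds 0) :=
    tendsto_of_tendsto_of_tendsto_of_le_of_le tendsto_const_nhds hW (fun _ => zero_le)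
      fun n => hle _ (.iUnion fun k => hf _)
  have hs := (ENNReal.tendsto_nat_tsum fun i => m (f i)).add hm
  simp only [← key, add_zero] at hs
  exact tendsto_nhds_unique tendsto_const_nhds hs

variable {M N : Type*} [MeasurableSpace M] [MeasurableSpace N]

theorem measureReal_rpow_submodular {β : ℝ} (h0 : 0 ≤ β) (h1 : β ≤ 1) (μ : Measure M)
    [IsFiniteMeasure μ] {A B : Set M} (hA : MeasurableSet A) (hB : MeasurableSet B) :
    μ.real (A ∪ B) ^ β + μ.real (A ∩ B) ^ β ≤ μ.real A ^ β + μ.real B ^ β := by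
  have e1 : μ.real A = μ.real (A ∩ B) + μ.real (A \ B) := (measureReal_inter_add_sdiff hB).symm
  have e2 : μ.real B = μ.real (A ∩ B) + μ.real (B \ A) := by
    rw [Set.inter_comm]; exact (measureReal_inter_add_sdiff hA).symm
  have e3 := measureReal_union_add_inter (μ := μ) (s := A) hB
  have e4 : μ.real (A ∪ B) = μ.real (A ∩ B) + μ.real (A \ B) + μ.real (B \ A) := by linarith
  rw [e4, e1, e2]
  exact rpow_add_add_rpow_le h0 h1 measureReal_nonneg measureReal_nonneg measureReal_nonneg

/-- The push-forward of `W` to the finite grid `I × J` is a matrix to which the combinatorial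
splitting applies. The splitting is lifted back as a density that is constant on the cells. -/
theorem exists_split_of_labels {I J : Type*} [Fintype I] [Fintype J]
    [MeasurableSpace I] [MeasurableSpace J] [DiscreteMeasurableSpace I] [DiscreteMeasurableSpace J]
    {β : ℝ} (h0 : 0 < β) (h1 : β ≤ 1) {K₁ K₂ : ℝ} (hK₁ : 0 ≤ K₁) (hK₂ : 0 ≤ K₂)
    (μ : Measure M) (ν : Measure N) (W : Measure (M × N)) [IsFiniteMeasure μ] [IsFiniteMeasure ν]
    [IsFiniteMeasure W]
    (h : ∀ E F, MeasurableSet E → MeasurableSet F →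
      W.real (E ×ˢ F) ≤ K₁ * μ.real E ^ β + K₂ * ν.real F ^ β)
    (k : M → I) (l : N → J) (hk : Measurable k) (hl : Measurable l) :
    ∃ W₁ W₂ : Measure (M × N), W₁ + W₂ = W ∧
      (∀ S : Set I, W₁.real ((k ⁻¹' S) ×ˢ Set.univ) ≤ K₁ * μ.real (k ⁻¹' S) ^ β) ∧
      (∀ T : Set J, W₂.real (Set.univ ×ˢ (l ⁻¹' T)) ≤ K₂ * ν.real (l ⁻¹' T) ^ β) := by
  classical
  let κ : M × N → I × J := Prod.map k l
  have hκ : Measurable κ := hk.prodMap hl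
  let V := W.map κ
  have : IsFiniteMeasure V := Measure.isFiniteMeasure_map W κ
  have hV : ∀ (S : Finset I) (T : Finset J),
      ∑ x ∈ S ×ˢ T, V.real {x} = W.real ((k ⁻¹' S) ×ˢ (l ⁻¹' T)) := by
    intro S T
    rw [sum_measureReal_singleton, map_measureReal_apply hκ (.of_discrete)]
    congr 1
    ext x
    simp [κ]
  obtain ⟨u, hu, huS, huT⟩ := exists_split_of_submodular Finset.univ
    (fun S : Finset I => K₁ * μ.real (k ⁻¹' S) ^ β) (fun T : Finset J => K₂ * ν.real (l ⁻¹' T) ^ β)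
    (fun x => V.real {x})
    (by
      intro S S'
      have := measureReal_rpow_submodular h0.le h1 μ (A := k ⁻¹' S) (B := k ⁻¹' S')
        (hk .of_discrete) (hk .of_discrete)
      rw [← mul_add, ← mul_add]
      push_cast
      exact mul_le_mul_of_nonneg_left this hK₁)
    (by
      intro S S'
      have := measureReal_rpow_submodular h0.le h1 ν (A := l ⁻¹' S) (B := l ⁻¹' S')
        (hl .of_discrete) (hl .of_discrete)
      rw [← mul_add, ← mul_add]
      push_cast
      exact mul_le_mul_of_nonneg_left this hK₂)
    (by simp [h0.ne']) (by simp [h0.ne']) (fun x => measureReal_nonneg) (by simp)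
    (by
      intro S T
      rw [hV]
      exact h _ _ (hk .of_discrete) (hl .of_discrete))
  -- On cells of measure zero the quotient is `0`, which is harmless because `0 ≤ u x ≤ V.real {x}`
  -- forces `u x = 0` there.
  let θ : I × J → ℝ := fun x => u x / V.real {x}
  have hθ : ∀ x, θ x * V.real {x} = u x := by
    intro x
    by_cases hx : V.real {x} = 0
    · have := hu x
      rw [hx] at this
      rw [hx]
      linarith
    · exact div_mul_cancel₀ _ hx
  have hθ0 : ∀ x, 0 ≤ θ x := fun x => div_nonneg (hu x).1 measureReal_nonneg
  have hθ1 : ∀ x, θ x ≤ 1 := fun x => div_le_one_of_le₀ (hu x).2 measureReal_nonneg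
  have hcalc : ∀ (φ : I × J → ℝ) (_ : ∀ x, 0 ≤ φ x) (D : Finset (I × J)),
      (W.withDensity (fun z => ENNReal.ofReal (φ (κ z)))).real (κ ⁻¹' D) =
        ∑ x ∈ D, φ x * V.real {x} := by
    intro φ hφ D
    rw [measureReal_def, withDensity_apply _ (hκ .of_discrete),
      ← setLIntegral_map (f := fun x => ENNReal.ofReal (φ x)) (.of_discrete) (.of_discrete) hκ,
      lintegral_finset, ENNReal.toReal_sum]
    · refine Finset.sum_congr rfl fun x _ => ?_
      rw [ENNReal.toReal_mul, ENNReal.toReal_ofReal (hφ x)]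
      rfl
    · intro x _
      exact ENNReal.mul_ne_top ENNReal.ofReal_ne_top (measure_ne_top _ _)
  refine ⟨W.withDensity (fun z => ENNReal.ofReal (θ (κ z))),
    W.withDensity (fun z => ENNReal.ofReal (1 - θ (κ z))), ?_, fun S => ?_, fun T => ?_⟩
  · rw [← withDensity_add_left]
    · have : ((fun z => ENNReal.ofReal (θ (κ z))) + fun z => ENNReal.ofReal (1 - θ (κ z))) = 1 := by
        funext z
        simp only [Pi.add_apply, Pi.one_apply]
        rw [← ENNReal.ofReal_add (hθ0 _) (by linarith [hθ1 (κ z)])]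
        simp
      rw [this, withDensity_one]
    · exact (Measurable.of_discrete (f := fun x => ENNReal.ofReal (θ x))).comp hκ
  · have := huS S.toFinset
    have e : (k ⁻¹' S) ×ˢ (Set.univ : Set N) =
        κ ⁻¹' ((S.toFinset ×ˢ Finset.univ : Finset (I × J)) : Set (I × J)) := by
      ext x; simp [κ]
    rw [e, hcalc θ hθ0]
    simp only [hθ]
    simpa using this
  · have := huT T.toFinset
    have e : (Set.univ : Set M) ×ˢ (l ⁻¹' T) =
        κ ⁻¹' ((Finset.univ ×ˢ T.toFinset : Finset (I × J)) : Set (I × J)) := by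
      ext x; simp [κ]
    rw [e, hcalc (fun x => 1 - θ x) (fun x => by linarith [hθ1 x])]
    simp only [sub_mul, one_mul, hθ]
    simpa using this

/-- Finitely many sets generate a finite partition, so the labelled version handles them after
restriction to their unions, where all measures are finite. -/
theorem exists_split_of_finset {β : ℝ} (h0 : 0 < β) (h1 : β ≤ 1) (K₁ K₂ : ℝ≥0)
    (μ : Measure M) (ν : Measure N) (W : Measure (M × N))
    (h : ∀ E F, MeasurableSet E → MeasurableSet F → μ E < ∞ → ν F < ∞ →
      W (E ×ˢ F) ≤ K₁ * μ E ^ β + K₂ * ν F ^ β)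
    (A : Finset (Set M)) (B : Finset (Set N)) (hA : ∀ E ∈ A, MeasurableSet E ∧ μ E < ∞)
    (hB : ∀ F ∈ B, MeasurableSet F ∧ ν F < ∞) :
    ∃ W₁ W₂ : Measure (M × N), W₁ + W₂ = W.restrict ((⋃ E ∈ A, E) ×ˢ (⋃ F ∈ B, F)) ∧
      (∀ E ∈ A, W₁ (E ×ˢ Set.univ) ≤ K₁ * μ E ^ β) ∧
      (∀ F ∈ B, W₂ (Set.univ ×ˢ F) ≤ K₂ * ν F ^ β) := by
  set X := ⋃ E ∈ A, E with hX
  set Y := ⋃ F ∈ B, F with hY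
  have mX : MeasurableSet X := Finset.measurableSet_biUnion _ fun E hE => (hA E hE).1
  have mY : MeasurableSet Y := Finset.measurableSet_biUnion _ fun E hE => (hB E hE).1
  have fX : μ X < ∞ := measure_biUnion_lt_top A.finite_toSet fun E hE => (hA E hE).2
  have fY : ν Y < ∞ := measure_biUnion_lt_top B.finite_toSet fun E hE => (hB E hE).2
  have fb : ∀ (K : ℝ≥0) (a : ℝ≥0∞), a < ∞ → K * a ^ β < ∞ := fun K a ha =>
    ENNReal.mul_lt_top ENNReal.coe_lt_top (ENNReal.rpow_lt_top_of_nonneg h0.le ha.ne)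
  have : IsFiniteMeasure (μ.restrict X) := ⟨by simpa using fX⟩
  have : IsFiniteMeasure (ν.restrict Y) := ⟨by simpa using fY⟩
  have : IsFiniteMeasure (W.restrict (X ×ˢ Y)) := ⟨by
    simpa using (h X Y mX mY fX fY).trans_lt (ENNReal.add_lt_top.2 ⟨fb _ _ fX, fb _ _ fY⟩)⟩
  -- The label of a point records which sets of the family contain it, so every `E ∈ A` is the
  -- preimage of a set of labels.
  let k : M → (A → Prop) := fun x E => x ∈ E.1
  let l : N → (B → Prop) := fun x E => x ∈ E.1
  have hk : Measurable k := measurable_pi_iff.2 fun E =>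
    measurableSet_setOfPred.1 (hA E.1 E.2).1
  have hl : Measurable l := measurable_pi_iff.2 fun E =>
    measurableSet_setOfPred.1 (hB E.1 E.2).1
  classical
  obtain ⟨W₁, W₂, hW, hS, hT⟩ := exists_split_of_labels h0 h1 K₁.2 K₂.2 (μ.restrict X)
    (ν.restrict Y) (W.restrict (X ×ˢ Y)) (by
      intro E F hE hF
      have hEf : μ (E ∩ X) < ∞ := (measure_mono Set.inter_subset_right).trans_lt fX
      have hFf : ν (F ∩ Y) < ∞ := (measure_mono Set.inter_subset_right).trans_lt fY
      have := h (E ∩ X) (F ∩ Y) (hE.inter mX) (hF.inter mY) hEf hFf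
      rw [measureReal_def, measureReal_def, measureReal_def, Measure.restrict_apply hE,
        Measure.restrict_apply hF, Measure.restrict_apply (hE.prod hF), Set.prod_inter_prod]
      refine (ENNReal.toReal_mono (ENNReal.add_lt_top.2 ⟨fb _ _ hEf, fb _ _ hFf⟩).ne this).trans ?_
      rw [ENNReal.toReal_add (fb _ _ hEf).ne (fb _ _ hFf).ne, ENNReal.toReal_mul,
        ENNReal.toReal_mul, ENNReal.toReal_rpow, ENNReal.toReal_rpow]
      rfl) k l hk hl
  have : IsFiniteMeasure W₁ := isFiniteMeasure_of_le (W.restrict (X ×ˢ Y)) (hW ▸ Measure.le_add_right le_rfl)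
  have : IsFiniteMeasure W₂ := isFiniteMeasure_of_le (W.restrict (X ×ˢ Y)) (hW ▸ Measure.le_add_left le_rfl)
  refine ⟨W₁, W₂, hW, fun E hE => ?_, fun F hF => ?_⟩
  · have := hS {s | s ⟨E, hE⟩}
    have e : k ⁻¹' {s | s ⟨E, hE⟩} = E := rfl
    have e' : E ∩ X = E := Set.inter_eq_left.2 (Set.subset_biUnion_of_mem (u := id) hE)
    rw [e, measureReal_def, measureReal_def, Measure.restrict_apply (hA E hE).1, e'] at this
    have h2 := fb K₁ _ (hA E hE).2
    rw [← ENNReal.toReal_le_toReal (measure_ne_top _ _) h2.ne, ENNReal.toReal_mul,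
      ← ENNReal.toReal_rpow]
    exact this
  · have := hT {s | s ⟨F, hF⟩}
    have e : l ⁻¹' {s | s ⟨F, hF⟩} = F := rfl
    have e' : F ∩ Y = F := Set.inter_eq_left.2 (Set.subset_biUnion_of_mem (u := id) hF)
    rw [e, measureReal_def, measureReal_def, Measure.restrict_apply (hB F hF).1, e'] at this
    have h2 := fb K₂ _ (hB F hF).2
    rw [← ENNReal.toReal_le_toReal (measure_ne_top _ _) h2.ne, ENNReal.toReal_mul,
      ← ENNReal.toReal_rpow]
    exact this

/-- A measure on a product dominated on rectangles by the sum of two concave powers of the sides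
splits into two measures, each dominated by one of them. -/
theorem exists_split_of_rect_le {β : ℝ} (h0 : 0 < β) (h1 : β ≤ 1) (K₁ K₂ : ℝ≥0)
    (μ : Measure M) (ν : Measure N) [SigmaFinite μ] [SigmaFinite ν] (W : Measure (M × N))
    (h : ∀ E F, MeasurableSet E → MeasurableSet F → μ E < ∞ → ν F < ∞ →
      W (E ×ˢ F) ≤ K₁ * μ E ^ β + K₂ * ν F ^ β) :
    ∃ W₁ W₂ : Measure (M × N), W₁ + W₂ = W ∧
      ∀ E F, MeasurableSet E → MeasurableSet F → μ E < ∞ → ν F < ∞ →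
        W₁ (E ×ˢ F) ≤ K₁ * μ E ^ β ∧ W₂ (E ×ˢ F) ≤ K₂ * ν F ^ β := by
  classical
  let TM := {E : Set M // MeasurableSet E ∧ μ E < ∞}
  let TN := {F : Set N // MeasurableSet F ∧ ν F < ∞}
  have stage : ∀ i : Finset TM × Finset TN, ∃ V : Measure (M × N) × Measure (M × N),
      V.1 + V.2 = W.restrict ((⋃ E ∈ i.1, E.1) ×ˢ (⋃ F ∈ i.2, F.1)) ∧
      (∀ E ∈ i.1, V.1 (E.1 ×ˢ Set.univ) ≤ K₁ * μ E.1 ^ β) ∧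
      (∀ F ∈ i.2, V.2 (Set.univ ×ˢ F.1) ≤ K₂ * ν F.1 ^ β) := by
    intro i
    obtain ⟨W₁, W₂, e, hE, hF⟩ := exists_split_of_finset h0 h1 K₁ K₂ μ ν W h
      (i.1.image Subtype.val) (i.2.image Subtype.val)
      (by intro E hE; obtain ⟨E, -, rfl⟩ := Finset.mem_image.1 hE; exact E.2)
      (by intro E hE; obtain ⟨E, -, rfl⟩ := Finset.mem_image.1 hE; exact E.2)
    refine ⟨(W₁, W₂), ?_, fun E h => hE _ (Finset.mem_image_of_mem _ h),
      fun E h => hF _ (Finset.mem_image_of_mem _ h)⟩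
    simpa only [Finset.set_biUnion_finset_image] using e
  choose V hV hVM hVN using stage
  -- Since `[0, ∞]` is compact, all set functions `V i` converge along an ultrafilter. It refines
  -- `atTop`, so each fixed set of finite measure eventually belongs to the family.
  let U : Ultrafilter (Finset TM × Finset TN) := Ultrafilter.of Filter.atTop
  have hU : (U : Filter (Finset TM × Finset TN)) ≤ Filter.atTop := Ultrafilter.of_le _
  let m₁ : Set (M × N) → ℝ≥0∞ := fun G => (U.map fun i => (V i).1 G).lim
  let m₂ : Set (M × N) → ℝ≥0∞ := fun G => (U.map fun i => (V i).2 G).lim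
  have t₁ : ∀ G, Filter.Tendsto (fun i => (V i).1 G) U (nhds (m₁ G)) := fun G =>
    Ultrafilter.le_nhds_lim _
  have t₂ : ∀ G, Filter.Tendsto (fun i => (V i).2 G) U (nhds (m₂ G)) := fun G =>
    Ultrafilter.le_nhds_lim _
  have add₁ : ∀ s t, MeasurableSet t → Disjoint s t → m₁ (s ∪ t) = m₁ s + m₁ t := by
    intro s t ht hd
    refine tendsto_nhds_unique (t₁ _) ?_
    simp only [measure_union hd ht]
    exact (t₁ s).add (t₁ t)
  have add₂ : ∀ s t, MeasurableSet t → Disjoint s t → m₂ (s ∪ t) = m₂ s + m₂ t := by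
    intro s t ht hd
    refine tendsto_nhds_unique (t₂ _) ?_
    simp only [measure_union hd ht]
    exact (t₂ s).add (t₂ t)
  have evM : ∀ E, ∀ hE : μ E < ∞, ∀ hm : MeasurableSet E,
      ∀ᶠ i in (U : Filter (Finset TM × Finset TN)), (⟨E, hm, hE⟩ : TM) ∈ i.1 := by
    intro E hE hm
    refine hU ?_
    filter_upwards [Filter.eventually_ge_atTop (({⟨E, hm, hE⟩} : Finset TM), (∅ : Finset TN))]
      with i hi
    exact hi.1 (Finset.mem_singleton_self _)
  have evN : ∀ F, ∀ hF : ν F < ∞, ∀ hm : MeasurableSet F,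
      ∀ᶠ i in (U : Filter (Finset TM × Finset TN)), (⟨F, hm, hF⟩ : TN) ∈ i.2 := by
    intro F hF hm
    refine hU ?_
    filter_upwards [Filter.eventually_ge_atTop ((∅ : Finset TM), ({⟨F, hm, hF⟩} : Finset TN))]
      with i hi
    exact hi.2 (Finset.mem_singleton_self _)
  have sum_eq : ∀ E F G, MeasurableSet E → MeasurableSet F → μ E < ∞ → ν F < ∞ →
      MeasurableSet G → G ⊆ E ×ˢ F → m₁ G + m₂ G = W G := by
    intro E F G hE hF fE fF hG hsub
    refine tendsto_nhds_unique ((t₁ G).add (t₂ G)) ?_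
    refine Filter.Tendsto.congr' ?_ tendsto_const_nhds
    filter_upwards [evM E fE hE, evN F fF hF] with i h1 h2
    rw [← Measure.add_apply, hV i, Measure.restrict_apply hG, Set.inter_eq_left.2]
    refine hsub.trans (Set.prod_mono ?_ ?_)
    · exact Set.subset_biUnion_of_mem (u := fun E : TM => E.1) h1
    · exact Set.subset_biUnion_of_mem (u := fun E : TN => E.1) h2
  have bd₁ : ∀ E F, MeasurableSet E → MeasurableSet F → μ E < ∞ → ν F < ∞ →
      m₁ (E ×ˢ F) ≤ K₁ * μ E ^ β := by
    intro E F hE hF fE fF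
    refine le_of_tendsto (t₁ _) ?_
    filter_upwards [evM E fE hE] with i hi
    exact (measure_mono (Set.prod_mono le_rfl (Set.subset_univ _))).trans (hVM i _ hi)
  have bd₂ : ∀ E F, MeasurableSet E → MeasurableSet F → μ E < ∞ → ν F < ∞ →
      m₂ (E ×ˢ F) ≤ K₂ * ν F ^ β := by
    intro E F hE hF fE fF
    refine le_of_tendsto (t₂ _) ?_
    filter_upwards [evN F fF hF] with i hi
    exact (measure_mono (Set.prod_mono (Set.subset_univ _) le_rfl)).trans (hVN i _ hi)
  -- Disjoint rectangles of finite measure covering the product. On each of them `W` is finite, so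
  -- the finitely additive limits are measures there.
  let P : ℕ × ℕ → Set (M × N) := fun n =>
    disjointed (spanningSets μ) n.1 ×ˢ disjointed (spanningSets ν) n.2
  have pM : ∀ n, MeasurableSet (disjointed (spanningSets μ) n) := fun n =>
    MeasurableSet.disjointed (measurableSet_spanningSets μ) n
  have pN : ∀ n, MeasurableSet (disjointed (spanningSets ν) n) := fun n =>
    MeasurableSet.disjointed (measurableSet_spanningSets ν) n
  have fM : ∀ n, μ (disjointed (spanningSets μ) n) < ∞ := fun n =>
    (measure_mono (disjointed_subset _ n)).trans_lt (measure_spanningSets_lt_top μ n)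
  have fN : ∀ n, ν (disjointed (spanningSets ν) n) < ∞ := fun n =>
    (measure_mono (disjointed_subset _ n)).trans_lt (measure_spanningSets_lt_top ν n)
  have mP : ∀ n, MeasurableSet (P n) := fun n => (pM _).prod (pN _)
  have dP : Pairwise (Function.onFun Disjoint P) := by
    intro n n' hn
    rw [Function.onFun, Set.disjoint_prod]
    by_cases h1 : n.1 = n'.1
    · exact Or.inr (disjoint_disjointed _ fun h2 => hn (Prod.ext h1 h2))
    · exact Or.inl (disjoint_disjointed _ h1)
  have uP : ⋃ n, P n = Set.univ := by
    refine Set.eq_univ_of_forall fun x => ?_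
    obtain ⟨i, hi⟩ := Set.mem_iUnion.1 (show x.1 ∈ ⋃ n, disjointed (spanningSets μ) n by
      simp only [iUnion_disjointed, iUnion_spanningSets, Set.mem_univ])
    obtain ⟨j, hj⟩ := Set.mem_iUnion.1 (show x.2 ∈ ⋃ n, disjointed (spanningSets ν) n by
      simp only [iUnion_disjointed, iUnion_spanningSets, Set.mem_univ])
    exact Set.mem_iUnion.2 ⟨(i, j), hi, hj⟩
  have finW : ∀ n, IsFiniteMeasure (W.restrict (P n)) := by
    intro n
    refine ⟨?_⟩
    rw [Measure.restrict_apply_univ]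
    refine (h _ _ (pM _) (pN _) (fM _) (fN _)).trans_lt (ENNReal.add_lt_top.2 ⟨?_, ?_⟩)
    · exact ENNReal.mul_lt_top ENNReal.coe_lt_top (ENNReal.rpow_lt_top_of_nonneg h0.le (fM _).ne)
    · exact ENNReal.mul_lt_top ENNReal.coe_lt_top (ENNReal.rpow_lt_top_of_nonneg h0.le (fN _).ne)
  -- The glued measure may be smaller than `m` on infinite unions of pieces; the inequality `V G ≤ m
  -- G` is enough to inherit the rectangle bounds.
  have glue : ∀ m : Set (M × N) → ℝ≥0∞,
      (∀ s t, MeasurableSet t → Disjoint s t → m (s ∪ t) = m s + m t) →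
      (∀ E F G, MeasurableSet E → MeasurableSet F → μ E < ∞ → ν F < ∞ →
        MeasurableSet G → G ⊆ E ×ˢ F → m G ≤ W G) →
      ∃ V : Measure (M × N), (∀ G, MeasurableSet G → V G = ∑' n, m (G ∩ P n)) ∧
        ∀ G, MeasurableSet G → V G ≤ m G := by
    intro m hadd hle
    have : ∀ n, ∃ V : Measure (M × N), ∀ G, MeasurableSet G → V G = m (G ∩ P n) := by
      intro n
      have := finW n
      refine exists_measure_of_le (W.restrict (P n)) (fun G => m (G ∩ P n)) ?_ ?_
      · intro s t hs ht hd
        rw [Set.union_inter_distrib_right, hadd _ _ (ht.inter (mP n))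
          (hd.mono Set.inter_subset_left Set.inter_subset_left)]
      · intro s hs
        rw [Measure.restrict_apply hs]
        exact hle _ _ _ (pM _) (pN _) (fM _) (fN _) (hs.inter (mP n)) Set.inter_subset_right
    choose Q hQ using this
    have hs : ∀ G, MeasurableSet G → Measure.sum Q G = ∑' n, m (G ∩ P n) := by
      intro G hG
      rw [Measure.sum_apply _ hG]
      exact tsum_congr fun n => hQ n G hG
    refine ⟨Measure.sum Q, hs, fun G hG => ?_⟩
    rw [hs G hG]
    refine ENNReal.summable.tsum_le_of_sum_le fun D => ?_
    have hm0 : m ∅ = 0 := by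
      have := hle ∅ ∅ ∅ .empty .empty (by simp) (by simp) .empty (by simp)
      simpa using this
    have hfin : ∀ D : Finset (ℕ × ℕ), ∑ n ∈ D, m (G ∩ P n) = m (G ∩ ⋃ n ∈ D, P n) := by
      intro D
      induction D using Finset.induction_on with
      | empty => simp [hm0]
      | insert n D hn ih =>
        rw [Finset.sum_insert hn, ih, Finset.set_biUnion_insert, Set.inter_union_distrib_left, hadd]
        · exact hG.inter (Finset.measurableSet_biUnion _ fun i _ => mP i)
        · refine Disjoint.mono Set.inter_subset_right Set.inter_subset_right ?_
          rw [Set.disjoint_iUnion₂_right]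
          intro i hi
          exact dP fun e => hn (e ▸ hi)
    rw [hfin]
    have mD : MeasurableSet (⋃ n ∈ D, P n) := Finset.measurableSet_biUnion _ fun i _ => mP i
    conv_rhs => rw [← Set.inter_union_sdiff G (⋃ n ∈ D, P n),
      hadd _ _ (hG.diff mD) Set.disjoint_sdiff_inter.symm]
    exact le_self_add
  obtain ⟨W₁, hW₁, le₁⟩ := glue m₁ add₁ fun E F G hE hF fE fF hG hs =>
    (sum_eq E F G hE hF fE fF hG hs) ▸ le_self_add
  obtain ⟨W₂, hW₂, le₂⟩ := glue m₂ add₂ fun E F G hE hF fE fF hG hs =>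
    (sum_eq E F G hE hF fE fF hG hs) ▸ le_add_self
  refine ⟨W₁, W₂, ?_, fun E F hE hF fE fF => ⟨(le₁ _ (hE.prod hF)).trans (bd₁ E F hE hF fE fF),
    (le₂ _ (hE.prod hF)).trans (bd₂ E F hE hF fE fF)⟩⟩
  ext G hG
  rw [Measure.add_apply, hW₁ G hG, hW₂ G hG, ← ENNReal.tsum_add]
  have : ∀ n, m₁ (G ∩ P n) + m₂ (G ∩ P n) = W (G ∩ P n) := fun n =>
    sum_eq _ _ _ (pM _) (pN _) (fM _) (fN _) (hG.inter (mP n)) Set.inter_subset_right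
  rw [tsum_congr this, ← measure_iUnion, ← Set.inter_iUnion, uP, Set.inter_univ]
  · exact fun i j hij => (dP hij).mono Set.inter_subset_right Set.inter_subset_right
  · exact fun n => hG.inter (mP n)

end

/-! ### Bochner measurability of the sections of a jointly measurable function. -/

section

variable {N 𝕜 : Type*} [MeasurableSpace N] [RCLike 𝕜]

open Classical in
/-- The `L^q(ν)`-valued function `x ↦ b (x, ·)`, with the value `0` where `b (x, ·)` is not in
`L^q(ν)`. -/
noncomputable def sectionLp {M : Type*} (q : ℝ≥0∞) (ν : Measure N) (b : M × N → 𝕜) : M → Lp 𝕜 q ν :=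
  fun x => if h : MemLp (fun y => b (x, y)) q ν then h.toLp else 0

theorem sectionLp_of_memLp {M : Type*} {q : ℝ≥0∞} {ν : Measure N} {b : M × N → 𝕜} {x : M}
    (h : MemLp (fun y => b (x, y)) q ν) : sectionLp q ν b x = h.toLp := dif_pos h

variable {M : Type*} [MeasurableSpace M]

/-- All sections of `b` are in `L^q(ν)` and depend on the first variable in a strongly measurable
way. -/
def MeasurableSections (q : ℝ≥0∞) [Fact (1 ≤ q)] (ν : Measure N) (b : M × N → 𝕜) : Prop :=
  (∀ x, MemLp (fun y => b (x, y)) q ν) ∧ StronglyMeasurable (sectionLp q ν b)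

theorem indicator_eq_of_mem_iff {Ω R : Type*} [Zero R] {S T : Set Ω} {f : Ω → R} {z : Ω}
    (h : z ∈ S ↔ z ∈ T) : S.indicator f z = T.indicator f z := by
  by_cases hz : z ∈ S
  · rw [Set.indicator_of_mem hz, Set.indicator_of_mem (h.1 hz)]
  · rw [Set.indicator_of_notMem hz, Set.indicator_of_notMem (mt h.2 hz)]

variable {q : ℝ≥0∞} [Fact (1 ≤ q)] {ν : Measure N} {b c : M × N → 𝕜}

theorem MeasurableSections.add (hb : MeasurableSections q ν b)
    (hc : MeasurableSections q ν c) : MeasurableSections q ν (b + c) := by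
  have h : ∀ x, MemLp (fun y => (b + c) (x, y)) q ν := fun x => (hb.1 x).add (hc.1 x)
  refine ⟨h, ?_⟩
  have e : sectionLp q ν (b + c) = sectionLp q ν b + sectionLp q ν c := by
    funext x
    rw [Pi.add_apply, sectionLp_of_memLp (h x), sectionLp_of_memLp (hb.1 x),
      sectionLp_of_memLp (hc.1 x), ← MemLp.toLp_add]
    rfl
  rw [e]
  exact hb.2.add hc.2

theorem MeasurableSections.const_smul (hb : MeasurableSections q ν b) (k : 𝕜) :
    MeasurableSections q ν (k • b) := by
  have h : ∀ x, MemLp (fun y => (k • b) (x, y)) q ν := fun x => (hb.1 x).const_smul k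
  refine ⟨h, ?_⟩
  have e : sectionLp q ν (k • b) = k • sectionLp q ν b := by
    funext x
    rw [Pi.smul_apply, sectionLp_of_memLp (h x), sectionLp_of_memLp (hb.1 x),
      ← MemLp.toLp_const_smul]
    rfl
  rw [e]
  exact hb.2.const_smul k

theorem measurableSections_zero : MeasurableSections q ν (0 : M × N → 𝕜) := by
  have h : ∀ x : M, MemLp (fun y => (0 : M × N → 𝕜) (x, y)) q ν := fun x => MemLp.zero
  refine ⟨h, ?_⟩
  have e : sectionLp q ν (0 : M × N → 𝕜) = fun _ => 0 := by
    funext x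
    rw [sectionLp_of_memLp (h x)]
    exact MemLp.toLp_zero _
  rw [e]
  exact stronglyMeasurable_const

theorem tendsto_eLpNorm_sub_of_dominated (hq : q ≠ ∞) {f : ℕ → N → 𝕜} {g : N → 𝕜}
    {G : N → ℝ} (hf : ∀ n, AEStronglyMeasurable (f n) ν) (hG : MemLp G q ν)
    (hfG : ∀ n y, ‖f n y‖ ≤ G y)
    (hlim : ∀ y, Filter.Tendsto (fun n => f n y) Filter.atTop (nhds (g y))) :
    Filter.Tendsto (fun n => eLpNorm (f n - g) q ν) Filter.atTop (nhds 0) := by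
  have hq0 : q ≠ 0 := (zero_lt_one.trans_le Fact.out).ne'
  have hg : AEStronglyMeasurable g ν :=
    aestronglyMeasurable_of_tendsto_ae Filter.atTop hf (.of_forall hlim)
  have hr : 0 < q.toReal := ENNReal.toReal_pos hq0 hq
  have hgG : ∀ y, ‖g y‖ ≤ G y := fun y => le_of_tendsto (hlim y).norm (.of_forall fun n => hfG n y)
  simp only [eLpNorm_eq_lintegral_rpow_enorm_toReal hq0 hq]
  have key : Filter.Tendsto (fun n => ∫⁻ y, ‖(f n - g) y‖ₑ ^ q.toReal ∂ν) Filter.atTop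
      (nhds (∫⁻ _, 0 ∂ν)) := by
    refine tendsto_lintegral_of_dominated_convergence' (fun y => ‖(2 : ℝ) * G y‖ₑ ^ q.toReal)
      (fun n => ((hf n).sub hg).enorm.pow_const _) (fun n => .of_forall fun y => ?_) ?_
      (.of_forall fun y => ?_)
    · refine ENNReal.rpow_le_rpow ?_ hr.le
      rw [enorm_le_iff_norm_le, Pi.sub_apply]
      refine (norm_sub_le _ _).trans ?_
      have := hfG n y
      have := hgG y
      rw [Real.norm_eq_abs]
      exact le_trans (by linarith) (le_abs_self _)
    · exact (lintegral_rpow_enorm_lt_top_of_eLpNorm_lt_top hq0 hq (hG.const_mul 2).2).ne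
    · have h1 : Filter.Tendsto (fun n => (f n - g) y) Filter.atTop (nhds 0) := by
        simpa using (hlim y).sub_const (g y)
      have h2 := (ENNReal.continuous_rpow_const (y := q.toReal)).tendsto 0 |>.comp
        (by simpa using h1.enorm)
      simpa [hr, Function.comp_def] using h2
  simp only [lintegral_zero] at key
  have := (ENNReal.continuous_rpow_const (y := 1 / q.toReal)).tendsto 0 |>.comp key
  simpa [hr, Function.comp_def] using this

/-- Dominated convergence in each section makes the `L^q(ν)`-valued functions converge pointwise in
norm, and strong measurability passes to the limit. -/
theorem measurableSections_of_tendsto (hq : q ≠ ∞) {f : ℕ → M × N → 𝕜}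
    {G : M × N → ℝ} (hf : ∀ n, MeasurableSections q ν (f n))
    (hG : ∀ x, MemLp (fun y => G (x, y)) q ν) (hfG : ∀ n z, ‖f n z‖ ≤ G z)
    (hlim : ∀ z, Filter.Tendsto (fun n => f n z) Filter.atTop (nhds (b z))) :
    MeasurableSections q ν b := by
  have hb : ∀ x, MemLp (fun y => b (x, y)) q ν := by
    intro x
    refine (hG x).mono (aestronglyMeasurable_of_tendsto_ae Filter.atTop
      (fun n => ((hf n).1 x).1) (.of_forall fun y => hlim (x, y))) (.of_forall fun y => ?_)
    exact (le_of_tendsto (hlim (x, y)).norm (.of_forall fun n => hfG n (x, y))).trans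
      (le_abs_self _)
  refine ⟨hb, stronglyMeasurable_of_tendsto Filter.atTop (fun n => (hf n).2) ?_⟩
  rw [tendsto_pi_nhds]
  intro x
  simp only [fun n => sectionLp_of_memLp ((hf n).1 x), sectionLp_of_memLp (hb x)]
  rw [Lp.tendsto_Lp_iff_tendsto_eLpNorm'']
  exact tendsto_eLpNorm_sub_of_dominated hq (fun n => ((hf n).1 x).1) (hG x)
    (fun n y => hfG n (x, y)) fun y => hlim (x, y)

/-- A π-λ argument from rectangles, where the section is a fixed `L^q` class on a measurable set and
`0` elsewhere. The strip of finite measure keeps all indicators in `L^q` and provides the dominating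
function. -/
theorem measurableSections_indicator (hq : q ≠ ∞) {F : Set N} (hF : MeasurableSet F)
    (hFν : ν F < ∞) {A : Set (M × N)} (hA : MeasurableSet A) :
    MeasurableSections q ν ((A ∩ Set.univ ×ˢ F).indicator (1 : M × N → 𝕜)) := by
  have rect : ∀ (E : Set M) (G : Set N), MeasurableSet E → MeasurableSet G →
      MeasurableSections q ν ((E ×ˢ G ∩ Set.univ ×ˢ F).indicator (1 : M × N → 𝕜)) := by
    intro E G hE hG
    have hGF : MemLp ((G ∩ F).indicator (fun _ => (1 : 𝕜))) q ν :=
      memLp_indicator_const q (hG.inter hF) _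
        (Or.inr ((measure_mono Set.inter_subset_right).trans_lt hFν).ne)
    have e1 : ∀ x ∈ E, (fun y => (E ×ˢ G ∩ Set.univ ×ˢ F).indicator (1 : M × N → 𝕜) (x, y)) =
        (G ∩ F).indicator (fun _ => (1 : 𝕜)) := by
      intro x hx
      funext y
      by_cases hy : y ∈ G ∩ F
      · rw [Set.indicator_of_mem hy, Set.indicator_of_mem
          (show (x, y) ∈ E ×ˢ G ∩ Set.univ ×ˢ F from ⟨⟨hx, hy.1⟩, trivial, hy.2⟩)]
        rfl
      · rw [Set.indicator_of_notMem hy, Set.indicator_of_notMem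
          fun h : (x, y) ∈ E ×ˢ G ∩ Set.univ ×ˢ F => hy ⟨h.1.2, h.2.2⟩]
    have e2 : ∀ x ∉ E, (fun y => (E ×ˢ G ∩ Set.univ ×ˢ F).indicator (1 : M × N → 𝕜) (x, y)) =
        0 := by
      intro x hx
      funext y
      rw [Set.indicator_of_notMem fun h : (x, y) ∈ E ×ˢ G ∩ Set.univ ×ˢ F => hx h.1.1]; rfl
    have hm : ∀ x, MemLp (fun y => (E ×ˢ G ∩ Set.univ ×ˢ F).indicator (1 : M × N → 𝕜) (x, y))
        q ν := by
      intro x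
      by_cases hx : x ∈ E
      · rw [e1 x hx]; exact hGF
      · rw [e2 x hx]; exact MemLp.zero
    refine ⟨hm, ?_⟩
    have e : sectionLp q ν ((E ×ˢ G ∩ Set.univ ×ˢ F).indicator (1 : M × N → 𝕜)) =
        E.indicator (fun _ => hGF.toLp) := by
      funext x
      rw [sectionLp_of_memLp (hm x)]
      by_cases hx : x ∈ E
      · rw [Set.indicator_of_mem hx]
        simp only [e1 x hx]
      · rw [Set.indicator_of_notMem hx]
        simp only [e2 x hx]
        exact MemLp.toLp_zero _
    rw [e]
    exact stronglyMeasurable_const.indicator hE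
  induction A, hA using MeasurableSpace.induction_on_inter generateFrom_prod.symm isPiSystem_prod with
  | empty =>
    rw [Set.empty_inter, Set.indicator_empty']
    exact measurableSections_zero
  | basic A hA =>
    obtain ⟨E, hE, G, hG, rfl⟩ := hA
    exact rect E G hE hG
  | compl A hA ih =>
    have h := (rect Set.univ Set.univ .univ .univ).add (ih.const_smul (-1))
    convert h using 1
    funext z
    by_cases h1 : z ∈ A <;> by_cases h2 : z.2 ∈ F <;>
      simp [Set.indicator, h1, h2]
  | iUnion A hd hA ih =>
    have hsum : ∀ n, MeasurableSections q ν
        (∑ i ∈ Finset.range n, (A i ∩ Set.univ ×ˢ F).indicator (1 : M × N → 𝕜)) := by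
      intro n
      induction n with
      | zero => simpa using measurableSections_zero
      | succ n ihn => rw [Finset.sum_range_succ]; exact ihn.add (ih n)
    have hval : ∀ n z, (∑ i ∈ Finset.range n, (A i ∩ Set.univ ×ˢ F).indicator (1 : M × N → 𝕜)) z =
        ((⋃ i ∈ Finset.range n, A i) ∩ Set.univ ×ˢ F).indicator 1 z := by
      intro n z
      rw [Set.iUnion₂_inter, Finset.sum_apply, Finset.indicator_biUnion]
      intro i _ j _ hij
      exact (hd hij).mono Set.inter_subset_left Set.inter_subset_left
    refine measurableSections_of_tendsto hq (G := (Set.univ ×ˢ F).indicator 1) hsum ?_ ?_ ?_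
    · intro x
      have : (fun y => (Set.univ ×ˢ F).indicator (1 : M × N → ℝ) (x, y)) =
          F.indicator (fun _ => (1 : ℝ)) := by
        funext y
        by_cases hy : y ∈ F
        · rw [Set.indicator_of_mem hy, Set.indicator_of_mem (show (x, y) ∈ Set.univ ×ˢ F from ⟨trivial, hy⟩)]
          rfl
        · rw [Set.indicator_of_notMem hy, Set.indicator_of_notMem
            fun h : (x, y) ∈ Set.univ ×ˢ F => hy h.2]
      rw [this]
      exact memLp_indicator_const q hF _ (Or.inr hFν.ne)
    · intro n z
      rw [hval]
      refine (norm_indicator_le_of_subset Set.inter_subset_right 1 z).trans ?_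
      rw [norm_indicator_eq_indicator_norm]
      refine Set.indicator_le_indicator ?_
      simp
    · intro z
      simp only [hval]
      refine tendsto_const_nhds.congr' ?_
      by_cases hz : ∃ i, z ∈ A i
      · obtain ⟨i, hi⟩ := hz
        filter_upwards [Filter.eventually_gt_atTop i] with n hn
        have h1 : z ∈ ⋃ i, A i := Set.mem_iUnion.2 ⟨i, hi⟩
        have h2 : z ∈ ⋃ i ∈ Finset.range n, A i :=
          Set.mem_biUnion (Finset.mem_coe.2 (Finset.mem_range.2 hn)) hi
        exact indicator_eq_of_mem_iff (by simp only [Set.mem_inter_iff, h1, h2])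
      · refine .of_forall fun n => ?_
        have h1 : z ∉ ⋃ i, A i := by simpa using hz
        have h2 : z ∉ ⋃ i ∈ Finset.range n, A i := by
          simp only [Set.mem_iUnion, not_exists] at hz ⊢
          exact fun i _ => hz i
        exact indicator_eq_of_mem_iff (by simp only [Set.mem_inter_iff, h1, h2])

/-- A jointly measurable function that lives on a strip of σ-finite measure and has sections in
`L^q` is the kernel of a strongly measurable function. -/
theorem measurableSections_of_sigmaFinite (hq : q ≠ ∞) {N₀ : Set N}
    (hN₀ : MeasurableSet N₀) [SigmaFinite (ν.restrict N₀)] (hb : StronglyMeasurable b)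
    (hbN : ∀ x y, y ∉ N₀ → b (x, y) = 0) (hmem : ∀ x, MemLp (fun y => b (x, y)) q ν) :
    MeasurableSections q ν b := by
  let F : ℕ → Set N := fun n => spanningSets (ν.restrict N₀) n ∩ N₀
  have hF : ∀ n, MeasurableSet (F n) := fun n => (measurableSet_spanningSets _ n).inter hN₀
  have hFν : ∀ n, ν (F n) < ∞ := fun n => by
    rw [← Measure.restrict_apply (measurableSet_spanningSets _ n)]
    exact measure_spanningSets_lt_top _ n
  borelize 𝕜
  have simple : ∀ (s : SimpleFunc (M × N) 𝕜) n,
      MeasurableSections q ν ((Set.univ ×ˢ F n).indicator s) := by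
    intro s n
    induction s using SimpleFunc.induction with
    | @const k A hA =>
      have := (measurableSections_indicator (𝕜 := 𝕜) hq (hF n) (hFν n) hA).const_smul k
      convert this using 1
      funext z
      by_cases h1 : z ∈ A <;> by_cases h2 : z.2 ∈ F n <;>
        simp [Set.indicator, h1, h2]
    | @add f g _ hf hg =>
      have := hf.add hg
      rwa [← Set.indicator_add'] at this
  have h0 : (0 : 𝕜) ∈ (Set.univ : Set 𝕜) := trivial
  -- The simple approximations `SimpleFunc.approxOn` satisfy `‖b_n‖ ≤ 2 ‖b‖`; they are cut off to
  -- strips of finite measure increasing to `N₀`.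
  refine measurableSections_of_tendsto hq (G := fun z => 2 * ‖b z‖)
    (fun n => simple (SimpleFunc.approxOn b hb.measurable Set.univ 0 h0 n) n) ?_ ?_ ?_
  · exact fun x => (hmem x).norm.const_mul 2
  · intro n z
    refine (norm_indicator_le_norm_self _ _).trans ?_
    have := SimpleFunc.norm_approxOn_zero_le hb.measurable h0 z n
    linarith
  · intro z
    by_cases hz : z.2 ∈ N₀
    · have h1 := SimpleFunc.tendsto_approxOn hb.measurable h0 (x := z) (by simp)
      refine h1.congr' ?_
      obtain ⟨i, hi⟩ := Set.mem_iUnion.1 (show z.2 ∈ ⋃ n, spanningSets (ν.restrict N₀) n by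
        simp [iUnion_spanningSets])
      filter_upwards [Filter.eventually_ge_atTop i] with n hn
      rw [Set.indicator_of_mem]
      exact ⟨trivial, monotone_spanningSets _ hn hi, hz⟩
    · rw [show z = (z.1, z.2) from rfl, hbN _ _ hz]
      refine tendsto_const_nhds.congr fun n => ?_
      rw [Set.indicator_of_notMem]
      exact fun h => hz h.2.2

end

/-! ### The lower bound: integrals of weak `L^p` functions over sets of finite measure. -/

section

section Exponents

variable {p q : ℝ≥0∞} [hq1 : Fact (1 ≤ q)]

theorem one_le_toReal (hq : q ≠ ∞) : 1 ≤ q.toReal := by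
  have := ENNReal.toReal_mono hq hq1.out
  simpa using this

theorem mul_alpha (hqp : q < p) : q.toReal * alpha p q = 1 - q.toReal / p.toReal := by
  have := one_le_toReal hqp.ne_top
  unfold alpha
  field_simp

theorem mul_alpha_pos (hqp : q < p) : 0 < q.toReal * alpha p q := by
  have h1 := one_le_toReal hqp.ne_top
  rw [mul_alpha hqp, sub_pos]
  by_cases hp : p = ∞
  · simp [hp]
  · have h2 := (ENNReal.toReal_lt_toReal hqp.ne_top hp).2 hqp
    rw [div_lt_one (by linarith)]
    exact h2

theorem mul_alpha_le_one (hqp : q < p) : q.toReal * alpha p q ≤ 1 := by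
  rw [mul_alpha hqp, sub_le_self_iff]
  positivity

theorem alpha_pos (hqp : q < p) : 0 < alpha p q := by
  have h1 := one_le_toReal hqp.ne_top
  exact (mul_pos_iff_of_pos_left (by linarith)).1 (mul_alpha_pos hqp)

theorem lowerConst_eq (hqp : q < p) :
    lowerConst p q = ENNReal.ofReal (q.toReal * alpha p q) ^ q.toReal⁻¹ := by
  have h1 := one_le_toReal hqp.ne_top
  unfold lowerConst
  congr 1
  rw [mul_alpha hqp, ENNReal.ofReal_sub _ (by positivity), ENNReal.ofReal_one]
  congr 1
  by_cases hp : p = ∞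
  · simp [hp]
  · rw [← ENNReal.toReal_div, ENNReal.ofReal_toReal]
    exact ENNReal.div_ne_top hqp.ne_top (pos_of_gt hqp).ne'

end Exponents

/-- Layer cake: on `E` the distribution function is at most `min (μ E) (C ^ s σ ^ (-s))`.
Integrating this minimum against `r σ ^ (r - 1)` produces exactly the factor `(1 - r/s)⁻¹`. -/
theorem setLIntegral_enorm_rpow_le_of_weak {M X : Type*} [MeasurableSpace M]
    [NormedAddCommGroup X] {μ : Measure M} {f : M → X} (hf : AEStronglyMeasurable f μ)
    {r s : ℝ} (hr : 0 < r) (hrs : r < s) {C : ℝ} (hC : 0 < C)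
    (h : ∀ σ : ℝ, 0 < σ → ENNReal.ofReal σ ^ s * μ {x | σ < ‖f x‖} ≤ ENNReal.ofReal C ^ s)
    {E : Set M} (hE0 : 0 < μ E) (hE : μ E < ∞) :
    ENNReal.ofReal (1 - r / s) * ∫⁻ x in E, ‖f x‖ₑ ^ r ∂μ ≤
      ENNReal.ofReal C ^ r * μ E ^ (1 - r / s) := by
  have hs : 0 < s := hr.trans hrs
  set m := (μ E).toReal with hm
  have hm0 : 0 < m := ENNReal.toReal_pos hE0.ne' hE.ne
  have hmE : μ E = ENNReal.ofReal m := (ENNReal.ofReal_toReal hE.ne).symm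
  -- The level at which the two bounds on the distribution function coincide.
  set σ₀ := C * m ^ (-(1 / s)) with hσ₀
  have hσ : 0 < σ₀ := by positivity
  have e0 : ∀ x, ‖f x‖ₑ ^ r = ENNReal.ofReal (‖f x‖ ^ r) := fun x => by
    rw [← ofReal_norm, ENNReal.ofReal_rpow_of_nonneg (norm_nonneg _) hr.le]
  simp only [e0]
  rw [lintegral_rpow_eq_lintegral_meas_lt_mul _ (.of_forall fun x => norm_nonneg _)
    hf.restrict.norm.aemeasurable hr]
  have hsplit : Set.Ioi (0 : ℝ) = Set.Ioc 0 σ₀ ∪ Set.Ioi σ₀ := (Set.Ioc_union_Ioi_eq_Ioi hσ.le).symm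
  have b1 : ∫⁻ σ in Set.Ioc 0 σ₀, (μ.restrict E) {a | σ < ‖f a‖} * ENNReal.ofReal (σ ^ (r - 1)) ≤
      ENNReal.ofReal (m * (σ₀ ^ r / r)) := by
    have hi : IntegrableOn (fun σ : ℝ => σ ^ (r - 1)) (Set.Ioc 0 σ₀) := by
      rw [← intervalIntegrable_iff_integrableOn_Ioc_of_le hσ.le]
      exact intervalIntegral.intervalIntegrable_rpow' (by linarith)
    calc _ ≤ ∫⁻ σ in Set.Ioc 0 σ₀, ENNReal.ofReal m * ENNReal.ofReal (σ ^ (r - 1)) := by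
          refine lintegral_mono fun σ => ?_
          have : (μ.restrict E) {a | σ < ‖f a‖} ≤ ENNReal.ofReal m := by
            rw [← hmE, ← Measure.restrict_apply_univ (μ := μ) E]
            exact measure_mono (Set.subset_univ _)
          gcongr
      _ = ENNReal.ofReal m * ENNReal.ofReal (σ₀ ^ r / r) := by
          rw [lintegral_const_mul' _ _ ENNReal.ofReal_ne_top, ← ofReal_integral_eq_lintegral_ofReal hi]
          · congr 2
            rw [← intervalIntegral.integral_of_le hσ.le, integral_rpow (Or.inl (by linarith))]
            simp [Real.zero_rpow hr.ne']
          · filter_upwards [ae_restrict_mem measurableSet_Ioc] with σ hσ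
            exact Real.rpow_nonneg hσ.1.le _
      _ = _ := by rw [← ENNReal.ofReal_mul hm0.le]
  have b2 : ∫⁻ σ in Set.Ioi σ₀, (μ.restrict E) {a | σ < ‖f a‖} * ENNReal.ofReal (σ ^ (r - 1)) ≤
      ENNReal.ofReal (C ^ s * (σ₀ ^ (r - s) / (s - r))) := by
    have hi : IntegrableOn (fun σ : ℝ => σ ^ (r - s - 1)) (Set.Ioi σ₀) :=
      integrableOn_Ioi_rpow_of_lt (by linarith) hσ
    calc _ ≤ ∫⁻ σ in Set.Ioi σ₀, ENNReal.ofReal (C ^ s) * ENNReal.ofReal (σ ^ (r - s - 1)) := by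
          refine setLIntegral_mono' measurableSet_Ioi fun σ hσ' => ?_
          have hσ0 : 0 < σ := hσ.trans hσ'
          have h1 := h σ hσ0
          have h2 : (μ.restrict E) {a | σ < ‖f a‖} ≤ μ {a | σ < ‖f a‖} := Measure.restrict_apply_le _ _
          rw [ENNReal.ofReal_rpow_of_pos hσ0, ENNReal.ofReal_rpow_of_pos hC] at h1
          have h3 : σ ^ (r - 1) = σ ^ s * σ ^ (r - s - 1) := by
            rw [← Real.rpow_add hσ0]; congr 1; ring
          rw [h3, ENNReal.ofReal_mul (by positivity), ← mul_assoc]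
          gcongr
          rw [mul_comm]
          exact (mul_le_mul_right h2 _).trans h1
      _ = ENNReal.ofReal (C ^ s) * ENNReal.ofReal (σ₀ ^ (r - s) / (s - r)) := by
          rw [lintegral_const_mul' _ _ ENNReal.ofReal_ne_top, ← ofReal_integral_eq_lintegral_ofReal hi]
          · congr 2
            rw [integral_Ioi_rpow_of_lt (by linarith) hσ, sub_add_cancel, ← neg_sub s r, div_neg,
              neg_div, neg_neg]
          · filter_upwards [ae_restrict_mem measurableSet_Ioi] with σ hσ'
            exact Real.rpow_nonneg (hσ.trans hσ').le _
      _ = _ := by rw [← ENNReal.ofReal_mul (by positivity)]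
  have hβ : 0 < 1 - r / s := by rw [sub_pos, div_lt_one hs]; exact hrs
  have hC2 : C ^ s = σ₀ ^ s * m := by
    rw [hσ₀, Real.mul_rpow hC.le (by positivity), ← Real.rpow_mul hm0.le]
    rw [show -(1 / s) * s = -1 by field_simp, Real.rpow_neg_one]
    field_simp
  have hC3 : C ^ r * m ^ (1 - r / s) = m * σ₀ ^ r := by
    rw [hσ₀, Real.mul_rpow hC.le (by positivity), ← Real.rpow_mul hm0.le, sub_eq_add_neg,
      Real.rpow_add hm0, Real.rpow_one, show -(1 / s) * r = -(r / s) by ring]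
    ring
  calc _ ≤ ENNReal.ofReal (1 - r / s) * (ENNReal.ofReal r *
        (ENNReal.ofReal (m * (σ₀ ^ r / r)) + ENNReal.ofReal (C ^ s * (σ₀ ^ (r - s) / (s - r))))) := by
        rw [hsplit]
        gcongr
        exact (lintegral_union_le _ _ _).trans (add_le_add b1 b2)
    _ = ENNReal.ofReal ((1 - r / s) * (r * (m * (σ₀ ^ r / r) +
          C ^ s * (σ₀ ^ (r - s) / (s - r))))) := by
        have : 0 < s - r := by linarith
        rw [ENNReal.ofReal_mul hβ.le, ENNReal.ofReal_mul hr.le, ENNReal.ofReal_add] <;> positivity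
    _ = ENNReal.ofReal (C ^ r * m ^ (1 - r / s)) := by
        congr 1
        have : s - r ≠ 0 := by linarith
        have h4 : C ^ s * (σ₀ ^ (r - s) / (s - r)) = m * σ₀ ^ r / (s - r) := by
          rw [hC2]
          have : σ₀ ^ r = σ₀ ^ s * σ₀ ^ (r - s) := by
            rw [← Real.rpow_add hσ]; congr 1; ring
          rw [this]; ring
        rw [h4, hC3]
        field_simp
        ring
    _ = _ := by
        rw [hmE, ENNReal.ofReal_rpow_of_pos hC, ENNReal.ofReal_rpow_of_pos hm0,
          ENNReal.ofReal_mul (by positivity)]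

theorem lowerConst_mul_setLIntegral_le {M X : Type*} [MeasurableSpace M]
    [NormedAddCommGroup X] {μ : Measure M} {f : M → X} (hf : AEStronglyMeasurable f μ)
    {p q : ℝ≥0∞} [Fact (1 ≤ q)] (hqp : q < p) {E : Set M} (hE0 : 0 < μ E)
    (hE : μ E < ∞) :
    lowerConst p q * (∫⁻ x in E, ‖f x‖ₑ ^ q.toReal ∂μ) ^ q.toReal⁻¹ ≤
      μ E ^ alpha p q * weakLpNorm f p μ := by
  have hr1 := one_le_toReal (q := q) hqp.ne_top
  have hr : 0 < q.toReal := by linarith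
  have hpow0 : μ E ^ alpha p q ≠ 0 := by
    simp [ENNReal.rpow_eq_zero_iff, hE0.ne', hE.ne]
  have hpowT : μ E ^ alpha p q ≠ ∞ :=
    ENNReal.rpow_ne_top_of_nonneg (alpha_pos hqp).le hE.ne
  have hinv : 0 ≤ q.toReal⁻¹ := by positivity
  rw [lowerConst_eq hqp, mul_comm (μ E ^ _), ← ENNReal.div_le_iff_le_mul (Or.inl hpow0) (Or.inl hpowT),
    ← ENNReal.mul_rpow_of_nonneg _ _ hinv]
  have hmulα := mul_alpha (p := p) (q := q) hqp
  have hα : alpha p q = (q.toReal * alpha p q) * q.toReal⁻¹ := by field_simp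
  have fin : ∀ C : ℝ≥0∞, ENNReal.ofReal (q.toReal * alpha p q) * ∫⁻ x in E, ‖f x‖ₑ ^ q.toReal ∂μ ≤
      C ^ q.toReal * μ E ^ (q.toReal * alpha p q) →
      (ENNReal.ofReal (q.toReal * alpha p q) * ∫⁻ x in E, ‖f x‖ₑ ^ q.toReal ∂μ) ^ q.toReal⁻¹ /
        μ E ^ alpha p q ≤ C := by
    intro C hC
    rw [ENNReal.div_le_iff_le_mul (Or.inl hpow0) (Or.inl hpowT)]
    refine (ENNReal.rpow_le_rpow hC hinv).trans ?_
    rw [ENNReal.mul_rpow_of_nonneg _ _ hinv, ENNReal.rpow_rpow_inv hr.ne', ← ENNReal.rpow_mul, ← hα]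
  unfold weakLpNorm
  split_ifs with hp
  · refine fin _ ?_
    have h1 : q.toReal * alpha p q = 1 := by rw [hmulα, hp]; simp
    rw [h1, ENNReal.ofReal_one, one_mul, ENNReal.rpow_one, ← setLIntegral_const]
    refine lintegral_mono_ae ?_
    filter_upwards [ae_restrict_of_ae (enorm_ae_le_eLpNormEssSup f μ)] with x hx
    rw [eLpNorm_exponent_top]
    exact ENNReal.rpow_le_rpow hx hr.le
  · refine le_sInf fun C hC => ?_
    -- Working with `D > C` ensures a positive constant, as the layer-cake estimate requires; `C`
    -- itself may be `0`.
    refine le_of_forall_gt_imp_ge_of_dense fun D hD => ?_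
    by_cases hDT : D = ∞
    · rw [hDT]; exact le_top
    · refine fin D ?_
      have hD0 : 0 < D.toReal := ENNReal.toReal_pos (pos_of_gt hD).ne' hDT
      have := setLIntegral_enorm_rpow_le_of_weak hf hr
        ((ENNReal.toReal_lt_toReal hqp.ne_top hp).2 hqp) hD0
        (fun σ hσ => (hC σ hσ).trans (by
          rw [ENNReal.ofReal_toReal hDT]
          exact ENNReal.rpow_le_rpow hD.le ENNReal.toReal_nonneg)) hE0 hE
      rwa [ENNReal.ofReal_toReal hDT, ← hmulα] at this

variable {M N 𝕜 : Type*} [MeasurableSpace M] [MeasurableSpace N] [RCLike 𝕜]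

theorem enorm_rpow_eq_lintegral_of_ae_eq {q : ℝ≥0∞} [Fact (1 ≤ q)] (hq : q ≠ ∞) {ν : Measure N}
    {f : Lp 𝕜 q ν} {g : N → 𝕜} (h : f =ᵐ[ν] g) :
    ‖f‖ₑ ^ q.toReal = ∫⁻ y, ‖g y‖ₑ ^ q.toReal ∂ν := by
  have hr := one_le_toReal (q := q) hq
  have hq0 : q ≠ 0 := (zero_lt_one.trans_le Fact.out).ne'
  rw [Lp.enorm_def, eLpNorm_congr_ae h, eLpNorm_eq_lintegral_rpow_enorm_toReal hq0 hq, one_div,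
    ENNReal.rpow_inv_rpow (by linarith)]

theorem eLpNorm_prod_rpow {q : ℝ≥0∞} [Fact (1 ≤ q)] (hq : q ≠ ∞) (μ : Measure M)
    (ν : Measure N) [SFinite ν] {b : M × N → 𝕜} (hb : StronglyMeasurable b) :
    eLpNorm b q (μ.prod ν) = (∫⁻ x, ∫⁻ y, ‖b (x, y)‖ₑ ^ q.toReal ∂ν ∂μ) ^ q.toReal⁻¹ := by
  have hq0 : q ≠ 0 := (zero_lt_one.trans_le Fact.out).ne'
  rw [eLpNorm_eq_lintegral_rpow_enorm_toReal hq0 hq, one_div,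
    lintegral_prod _ (hb.enorm.pow_const _).aemeasurable]

theorem lowerConst_mul_eLpNorm_le {p q : ℝ≥0∞} [Fact (1 ≤ q)] (hqp : q < p) {μ : Measure M}
    {ν : Measure N} {b : M × N → 𝕜} (hb : StronglyMeasurable b) {E : Set M} {F : Set N}
    (hE0 : 0 < μ E) (hE : μ E < ∞) (hF : ν F < ∞) :
    lowerConst p q * eLpNorm b q ((μ.restrict E).prod (ν.restrict F)) ≤
      μ E ^ alpha p q * mixedNorm p q μ ν b := by
  have hr := one_le_toReal (q := q) hqp.ne_top
  have hpow0 : μ E ^ alpha p q ≠ 0 := by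
    simp [ENNReal.rpow_eq_zero_iff, hE0.ne', hE.ne]
  have hpowT : μ E ^ alpha p q ≠ ∞ :=
    ENNReal.rpow_ne_top_of_nonneg (alpha_pos hqp).le hE.ne
  have : IsFiniteMeasure (ν.restrict F) := ⟨by simpa using hF⟩
  unfold mixedNorm
  rw [mul_comm (μ E ^ _), ← ENNReal.div_le_iff_le_mul (Or.inl hpow0) (Or.inl hpowT)]
  refine le_iInf fun f => le_iInf fun hf => le_iInf fun hk => ?_
  rw [ENNReal.div_le_iff_le_mul (Or.inl hpow0) (Or.inl hpowT), mul_comm _ (μ E ^ _)]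
  refine le_trans ?_ (lowerConst_mul_setLIntegral_le hf hqp hE0 hE)
  rw [eLpNorm_prod_rpow hqp.ne_top _ _ hb]
  refine mul_le_mul_right (ENNReal.rpow_le_rpow (lintegral_mono_ae ?_) (by positivity)) _
  filter_upwards [ae_restrict_of_ae hk.2] with x hx
  rw [enorm_rpow_eq_lintegral_of_ae_eq hqp.ne_top hx]
  exact setLIntegral_le_lintegral _ _

theorem stronglyMeasurable_of_mixedNorm_ne_top {p q : ℝ≥0∞} [Fact (1 ≤ q)] {μ : Measure M}
    {ν : Measure N} {b : M × N → 𝕜} (h : mixedNorm p q μ ν b ≠ ∞) : StronglyMeasurable b := by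
  by_contra hb
  refine h ?_
  simp only [mixedNorm, iInf_eq_top]
  exact fun f _ hk => absurd hk.1 hb

/-- Triangle inequality in `L^q(E × F)`, with `μ(E)^α` and `t⁻¹ ν(F)^α` both at most their maximum.
Only decompositions with both norms finite matter, and their terms are measurable. -/
theorem lowerConst_mul_rectNorm_le {p q : ℝ≥0∞} [Fact (1 ≤ q)] (hqp : q < p) (μ : Measure M)
    (ν : Measure N) {t : ℝ≥0} (ht : 0 < t) (a : M × N → 𝕜) :
    lowerConst p q * rectNorm p q μ ν t a ≤ kFunctional p q μ ν t a := by
  have ht0 : (t : ℝ≥0∞) ≠ 0 := by simpa using ht.ne'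
  unfold kFunctional
  refine le_iInf fun b => le_iInf fun c => le_iInf fun hab => ?_
  by_cases hbT : mixedNorm p q μ ν b = ∞
  · simp [hbT]
  by_cases hcT : mixedNorm p q ν μ (c ∘ Prod.swap) = ∞
  · simp [hcT, ENNReal.mul_top ht0]
  have hb := stronglyMeasurable_of_mixedNorm_ne_top hbT
  have hc' := stronglyMeasurable_of_mixedNorm_ne_top hcT
  have hc : StronglyMeasurable c := by
    have := hc'.comp_measurable measurable_swap
    simpa [Function.comp_assoc] using this
  unfold rectNorm
  simp only [ENNReal.mul_iSup]
  refine iSup_le fun E => iSup_le fun F => iSup_le fun mE => iSup_le fun mF => iSup_le fun hE0 =>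
    iSup_le fun hE => iSup_le fun hF0 => iSup_le fun hF => ?_
  have hα := alpha_pos (q := q) hqp
  have : IsFiniteMeasure (ν.restrict F) := ⟨by simpa using hF⟩
  have : IsFiniteMeasure (μ.restrict E) := ⟨by simpa using hE⟩
  have e1 := lowerConst_mul_eLpNorm_le hqp hb hE0 hE hF
  have e2 := lowerConst_mul_eLpNorm_le hqp hc' hF0 hF hE
  rw [eLpNorm_comp_measurePreserving hc.aestronglyMeasurable
    (Measure.measurePreserving_swap (μ := ν.restrict F) (ν := μ.restrict E))] at e2
  set A := μ E ^ alpha p q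
  set B := ν F ^ alpha p q
  set mx := max A ((t : ℝ≥0∞)⁻¹ * B) with hmx
  have hA0 : A ≠ 0 := by simp [A, ENNReal.rpow_eq_zero_iff, hE0.ne', hE.ne]
  have hmx0 : mx ≠ 0 := ((pos_iff_ne_zero.2 hA0).trans_le (le_max_left _ _)).ne'
  have hmxT : mx ≠ ∞ := by
    refine (max_lt (ENNReal.rpow_lt_top_of_nonneg hα.le hE.ne) (ENNReal.mul_lt_top ?_
      (ENNReal.rpow_lt_top_of_nonneg hα.le hF.ne))).ne
    simpa using ht
  have hB : B ≤ mx * t := by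
    calc B = (t : ℝ≥0∞)⁻¹ * B * t := by
          rw [mul_comm, ← mul_assoc, ENNReal.mul_inv_cancel ht0 ENNReal.coe_ne_top, one_mul]
      _ ≤ mx * t := by gcongr; exact le_max_right _ _
  rw [← mul_assoc, mul_comm (lowerConst p q), mul_assoc, ENNReal.inv_mul_le_iff hmx0 hmxT]
  calc _ ≤ lowerConst p q * (eLpNorm b q ((μ.restrict E).prod (ν.restrict F)) +
        eLpNorm c q ((μ.restrict E).prod (ν.restrict F))) := by
        gcongr
        rw [eLpNorm_congr_ae (hab E F mE mF hE hF)]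
        exact eLpNorm_add_le hb.aestronglyMeasurable hc.aestronglyMeasurable Fact.out
    _ ≤ A * mixedNorm p q μ ν b + B * mixedNorm p q ν μ (c ∘ Prod.swap) := by
        rw [mul_add]; exact add_le_add e1 e2
    _ ≤ mx * mixedNorm p q μ ν b + mx * t * mixedNorm p q ν μ (c ∘ Prod.swap) := by
        gcongr
        exact le_max_left _ _
    _ = _ := by ring

end

/-! ### The upper bound over σ-finite measures. -/

section

variable {M N 𝕜 : Type*} [MeasurableSpace M] [MeasurableSpace N] [RCLike 𝕜]

/-- The weak-type bound by `D` in `L^{p,∞}(μ)` of a function `B`, the `r`-th power of a norm. -/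
def WeakBound (p : ℝ≥0∞) (r : ℝ) (μ : Measure M) (B : M → ℝ≥0∞) (D : ℝ≥0∞) : Prop :=
  (∀ᵐ x ∂μ, B x < ∞) ∧ (p = ∞ → ∀ᵐ x ∂μ, B x ≤ D ^ r) ∧
    (p ≠ ∞ → ∀ σ : ℝ, 0 < σ →
      ENNReal.ofReal σ ^ p.toReal * μ {x | ENNReal.ofReal σ ^ r < B x} ≤ D ^ p.toReal)

theorem WeakBound.mono_right {p : ℝ≥0∞} {r : ℝ} (hr : 0 ≤ r) {μ : Measure M} {B : M → ℝ≥0∞}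
    {D D' : ℝ≥0∞} (h : WeakBound p r μ B D) (hD : D ≤ D') : WeakBound p r μ B D' :=
  ⟨h.1, fun hp => (h.2.1 hp).mono fun _ hx => hx.trans (ENNReal.rpow_le_rpow hD hr),
    fun hp σ hσ => (h.2.2 hp σ hσ).trans (ENNReal.rpow_le_rpow hD ENNReal.toReal_nonneg)⟩

/-- Links the scalar functions `x ↦ ∫ |b(x, ·)|^q` to the Bochner definition: on a σ-finite strip,
joint measurability already provides the required `L^q`-valued function. -/
theorem mixedNorm_le_of_weakBound {p q : ℝ≥0∞} [Fact (1 ≤ q)] (hq : q ≠ ∞) {μ : Measure M}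
    {ν : Measure N} {b : M × N → 𝕜} (hb : StronglyMeasurable b) {N₀ : Set N}
    (hN₀ : MeasurableSet N₀) [SigmaFinite (ν.restrict N₀)] (hbN : ∀ x y, y ∉ N₀ → b (x, y) = 0)
    {D : ℝ≥0∞} (h : WeakBound p q.toReal μ (fun x => ∫⁻ y, ‖b (x, y)‖ₑ ^ q.toReal ∂ν) D) :
    mixedNorm p q μ ν b ≤ D := by
  have hr1 := one_le_toReal (q := q) hq
  have hr : 0 < q.toReal := by linarith
  have hq0 : q ≠ 0 := (zero_lt_one.trans_le Fact.out).ne'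
  set B : M → ℝ≥0∞ := fun x => ∫⁻ y, ‖b (x, y)‖ₑ ^ q.toReal ∂ν with hB
  have hBm : Measurable B := by
    have e : B = fun x => ∫⁻ y, ‖b (x, y)‖ₑ ^ q.toReal ∂(ν.restrict N₀) := by
      funext x
      refine (setLIntegral_eq_of_support_subset fun y hy => ?_).symm
      by_contra hy'
      exact hy (by simp [hbN x y hy', hr])
    rw [e]
    exact (hb.enorm.pow_const _).lintegral_prod_right'
  -- Erasing the null set of bad rows puts every section in `L^q`; `b` remains a kernel because this
  -- is only required almost everywhere.
  let b' : M × N → 𝕜 := ({x | B x < ∞} ×ˢ Set.univ).indicator b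
  have hG : MeasurableSet {x | B x < ∞} := measurableSet_lt hBm measurable_const
  have hb' : StronglyMeasurable b' := hb.indicator (hG.prod .univ)
  have hb'1 : ∀ x, B x < ∞ → (fun y => b' (x, y)) = fun y => b (x, y) := by
    intro x hx
    funext y
    exact Set.indicator_of_mem (show (x, y) ∈ {x | B x < ∞} ×ˢ Set.univ from ⟨hx, trivial⟩) _
  have hmem : ∀ x, MemLp (fun y => b' (x, y)) q ν := by
    intro x
    refine ⟨(hb'.comp_measurable measurable_prodMk_left).aestronglyMeasurable, ?_⟩
    by_cases hx : B x < ∞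
    · rw [hb'1 x hx, eLpNorm_lt_top_iff_lintegral_rpow_enorm_lt_top hq0 hq]
      exact hx
    · have : (fun y => b' (x, y)) = 0 := by
        funext y
        exact Set.indicator_of_notMem
          (fun h : (x, y) ∈ {x | B x < ∞} ×ˢ Set.univ => hx h.1) _
      rw [this, eLpNorm_zero]
      exact ENNReal.zero_lt_top
  have hs := measurableSections_of_sigmaFinite hq hN₀ hb'
    (fun x y hy => by simp only [b', Set.indicator, hbN x y hy, ite_self]) hmem
  have hker : ∀ x, B x < ∞ → sectionLp q ν b' x =ᵐ[ν] fun y => b (x, y) := by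
    intro x hx
    rw [sectionLp_of_memLp (hmem x), ← hb'1 x hx]
    exact (hmem x).coeFn_toLp
  have hnorm : ∀ x, B x < ∞ → ‖sectionLp q ν b' x‖ₑ ^ q.toReal = B x := fun x hx =>
    enorm_rpow_eq_lintegral_of_ae_eq hq (hker x hx)
  refine (iInf₂_le_of_le (sectionLp q ν b') hs.2.aestronglyMeasurable
    (iInf_le _ ⟨hb, h.1.mono hker⟩)).trans ?_
  unfold weakLpNorm
  split_ifs with hp
  · rw [eLpNorm_exponent_top]
    refine essSup_le_of_ae_le _ ?_
    filter_upwards [h.1, h.2.1 hp] with x h1 h2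
    rw [← hnorm x h1] at h2
    exact (ENNReal.rpow_le_rpow_iff hr).1 h2
  · refine sInf_le fun σ hσ => ?_
    refine le_trans ?_ (h.2.2 hp σ hσ)
    refine mul_le_mul_right (measure_mono_ae ?_) _
    filter_upwards [h.1] with x h1 h2
    change ENNReal.ofReal σ ^ q.toReal < B x
    rw [← hnorm x h1]
    refine ENNReal.rpow_lt_rpow ?_ hr
    rw [← ofReal_norm]
    exact (ENNReal.ofReal_lt_ofReal_iff_of_nonneg hσ.le).2 h2

/-- Chebyshev on the level set itself: if `B > σ^q` on `E`, then `σ^q μ(E) ≤ D^q μ(E)^(1 - q/p)`,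
hence `σ^p μ(E) ≤ D^p`. No constant is lost in this direction. -/
theorem weakBound_of_setLIntegral_le {p q : ℝ≥0∞} [Fact (1 ≤ q)] (hqp : q < p) {μ : Measure M}
    [SigmaFinite μ] {B : M → ℝ≥0∞} (hB : Measurable B) {D : ℝ≥0∞} (hD : D ≠ ∞)
    (h : ∀ E, MeasurableSet E → μ E < ∞ →
      ∫⁻ x in E, B x ∂μ ≤ D ^ q.toReal * μ E ^ (q.toReal * alpha p q)) :
    WeakBound p q.toReal μ B D := by
  have hr1 := one_le_toReal (q := q) hqp.ne_top
  have hr : 0 < q.toReal := by linarith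
  have hβ := mul_alpha_pos (p := p) (q := q) hqp
  have hβ' := mul_alpha (p := p) (q := q) hqp
  refine ⟨?_, fun hp => ?_, fun hp σ hσ => ?_⟩
  · refine ae_of_forall_measure_lt_top_ae_restrict _ fun E hE hEμ => ?_
    refine ae_lt_top hB ((h E hE hEμ).trans_lt ?_).ne
    exact ENNReal.mul_lt_top (ENNReal.rpow_lt_top_of_nonneg hr.le hD)
      (ENNReal.rpow_lt_top_of_nonneg hβ.le hEμ.ne)
  · refine ae_le_of_forall_setLIntegral_le_of_sigmaFinite hB fun E hE hEμ => ?_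
    rw [setLIntegral_const]
    refine (h E hE hEμ).trans ?_
    rw [hβ', hp]
    simp
  · have hs : q.toReal < p.toReal := (ENNReal.toReal_lt_toReal hqp.ne_top hp).2 hqp
    have hs0 : 0 < p.toReal := hr.trans hs
    have hL : MeasurableSet {x | ENNReal.ofReal σ ^ q.toReal < B x} :=
      measurableSet_lt measurable_const hB
    rw [← Measure.iSup_restrict_spanningSets, ENNReal.mul_iSup]
    refine iSup_le fun n => ?_
    rw [Measure.restrict_apply hL]
    set E := {x | ENNReal.ofReal σ ^ q.toReal < B x} ∩ spanningSets μ n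
    have hE : MeasurableSet E := hL.inter (measurableSet_spanningSets μ n)
    have hEμ : μ E < ∞ :=
      (measure_mono Set.inter_subset_right).trans_lt (measure_spanningSets_lt_top μ n)
    by_cases hE0 : μ E = 0
    · simp [hE0]
    have h1 : ENNReal.ofReal σ ^ q.toReal * μ E ≤
        D ^ q.toReal * μ E ^ (q.toReal * alpha p q) := by
      refine le_trans ?_ (h E hE hEμ)
      rw [← setLIntegral_const]
      exact setLIntegral_mono' hE fun x hx => le_of_lt hx.1
    have h2 : ENNReal.ofReal σ ^ q.toReal * μ E ^ (q.toReal / p.toReal) ≤ D ^ q.toReal := by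
      have e : μ E = μ E ^ (q.toReal / p.toReal) * μ E ^ (q.toReal * alpha p q) := by
        rw [← ENNReal.rpow_add _ _ hE0 hEμ.ne, hβ']
        simp
      rw [e, ← mul_assoc] at h1
      rw [← e] at h1
      refine (ENNReal.mul_le_mul_iff_left ?_ ?_).1 h1
      · simp [ENNReal.rpow_eq_zero_iff, hE0, hEμ.ne]
      · exact ENNReal.rpow_ne_top_of_nonneg hβ.le hEμ.ne
    have h3 := ENNReal.rpow_le_rpow h2 (show 0 ≤ p.toReal / q.toReal by positivity)
    rw [ENNReal.mul_rpow_of_nonneg _ _ (by positivity), ← ENNReal.rpow_mul, ← ENNReal.rpow_mul,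
      ← ENNReal.rpow_mul, mul_div_cancel₀ _ hr.ne',
      show q.toReal / p.toReal * (p.toReal / q.toReal) = 1 by field_simp, ENNReal.rpow_one] at h3
    exact h3

theorem lintegral_rect_eq_withDensity {μ : Measure M} {ν : Measure N} [SFinite μ] [SFinite ν]
    {a : M × N → 𝕜} (ha : StronglyMeasurable a) (r : ℝ) {E : Set M} {F : Set N}
    {θ : M × N → ℝ≥0∞} (hθ : Measurable θ) (hE : MeasurableSet E) (hF : MeasurableSet F) :
    ∫⁻ x in E, ∫⁻ y in F, θ (x, y) * ‖a (x, y)‖ₑ ^ r ∂ν ∂μ =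
      ∫⁻ z in E ×ˢ F, θ z ∂((μ.prod ν).withDensity fun z => ‖a z‖ₑ ^ r) := by
  have ham : Measurable fun z => ‖a z‖ₑ ^ r := ha.enorm.pow_const _
  rw [setLIntegral_withDensity_eq_setLIntegral_mul _ ham hθ (hE.prod hF), ← Measure.prod_restrict,
    lintegral_prod _ (ham.mul hθ).aemeasurable]
  simp only [Pi.mul_apply, mul_comm]

theorem eLpNorm_rect_le {p q : ℝ≥0∞} {μ : Measure M} {ν : Measure N} {t : ℝ≥0} (ht : 0 < t)
    [Fact (1 ≤ q)] (hqp : q < p) {a : M × N → 𝕜} {E : Set M} {F : Set N} (hE : MeasurableSet E)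
    (hF : MeasurableSet F) (hEμ : μ E < ∞) (hFν : ν F < ∞) :
    eLpNorm a q ((μ.restrict E).prod (ν.restrict F)) ≤ rectNorm p q μ ν t a *
      max (μ E ^ alpha p q) ((t : ℝ≥0∞)⁻¹ * ν F ^ alpha p q) := by
  have : IsFiniteMeasure (ν.restrict F) := ⟨by simpa using hFν⟩
  by_cases hE0 : μ E = 0
  · simp [Measure.restrict_eq_zero.2 hE0]
  by_cases hF0 : ν F = 0
  · simp [Measure.restrict_eq_zero.2 hF0]
  have hα := alpha_pos (q := q) hqp
  set mx := max (μ E ^ alpha p q) ((t : ℝ≥0∞)⁻¹ * ν F ^ alpha p q) with hmx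
  have hA0 : μ E ^ alpha p q ≠ 0 := by simp [ENNReal.rpow_eq_zero_iff, hE0, hEμ.ne]
  have hmx0 : mx ≠ 0 := ((pos_iff_ne_zero.2 hA0).trans_le (le_max_left _ _)).ne'
  have hmxT : mx ≠ ∞ := by
    refine (max_lt (ENNReal.rpow_lt_top_of_nonneg hα.le hEμ.ne) (ENNReal.mul_lt_top ?_
      (ENNReal.rpow_lt_top_of_nonneg hα.le hFν.ne))).ne
    simpa using ht
  rw [mul_comm, ← ENNReal.inv_mul_le_iff hmx0 hmxT]
  exact le_iSup_of_le E <| le_iSup_of_le F <| le_iSup_of_le hE <| le_iSup_of_le hF <|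
    le_iSup_of_le (pos_iff_ne_zero.2 hE0) <| le_iSup_of_le hEμ <|
    le_iSup_of_le (pos_iff_ne_zero.2 hF0) <| le_iSup_of_le hFν le_rfl

theorem lintegral_rect_le {p q : ℝ≥0∞} {μ : Measure M} {ν : Measure N} {t : ℝ≥0} (ht : 0 < t)
    [Fact (1 ≤ q)] (hqp : q < p) {a : M × N → 𝕜} (ha : StronglyMeasurable a) {E : Set M}
    {F : Set N} (hE : MeasurableSet E)
    (hF : MeasurableSet F) (hEμ : μ E < ∞) (hFν : ν F < ∞) :
    ∫⁻ x in E, ∫⁻ y in F, ‖a (x, y)‖ₑ ^ q.toReal ∂ν ∂μ ≤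
      max (rectNorm p q μ ν t a ^ q.toReal * μ E ^ (q.toReal * alpha p q))
        ((rectNorm p q μ ν t a * (t : ℝ≥0∞)⁻¹) ^ q.toReal * ν F ^ (q.toReal * alpha p q)) := by
  have hr1 := one_le_toReal (q := q) hqp.ne_top
  have hr : 0 < q.toReal := by linarith
  have : IsFiniteMeasure (ν.restrict F) := ⟨by simpa using hFν⟩
  have h := eLpNorm_rect_le (a := a) (p := p) (q := q) ht hqp hE hF hEμ hFν
  rw [eLpNorm_prod_rpow hqp.ne_top _ _ ha, ENNReal.rpow_inv_le_iff hr] at h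
  refine h.trans (le_of_eq ?_)
  rw [mul_comm q.toReal, ENNReal.rpow_mul, ENNReal.rpow_mul,
    ← ENNReal.mul_rpow_of_nonneg _ _ hr.le, ← ENNReal.mul_rpow_of_nonneg _ _ hr.le,
    ← (ENNReal.monotone_rpow_of_nonneg hr.le).map_max, mul_assoc, ← mul_max]

theorem setLIntegral_le_of_rect {μ : Measure M} {ν : Measure N} [SigmaFinite ν]
    {f : M × N → ℝ≥0∞} (hf : Measurable f) {K : ℝ≥0∞} {E : Set M}
    (h : ∀ F, MeasurableSet F → ν F < ∞ → ∫⁻ x in E, ∫⁻ y in F, f (x, y) ∂ν ∂μ ≤ K) :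
    ∫⁻ x in E, ∫⁻ y, f (x, y) ∂ν ∂μ ≤ K := by
  have e : ∀ x, ∫⁻ y, f (x, y) ∂ν = ⨆ n, ∫⁻ y in spanningSets ν n, f (x, y) ∂ν := by
    intro x
    rw [← setLIntegral_univ, ← iUnion_spanningSets ν]
    exact setLIntegral_iUnion_of_directed _
      (monotone_spanningSets ν).directed_le
  simp only [e]
  rw [lintegral_iSup (fun n => hf.lintegral_prod_right')]
  · exact iSup_le fun n => h _ (measurableSet_spanningSets ν n) (measure_spanningSets_lt_top ν n)
  · intro m n hmn x
    exact lintegral_mono_set (monotone_spanningSets ν hmn)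

/-- Over σ-finite measures, a function with finite rectangle norm splits into two functions with
weak-type bounds on the norms of their sections. -/
theorem exists_decomposition_of_sigmaFinite {p q : ℝ≥0∞} [Fact (1 ≤ q)] (hqp : q < p)
    (μ : Measure M) (ν : Measure N) [SigmaFinite μ] [SigmaFinite ν] {t : ℝ≥0} (ht : 0 < t)
    {a : M × N → 𝕜} (ha : StronglyMeasurable a) (hR : rectNorm p q μ ν t a ≠ ∞) :
    ∃ b c : M × N → 𝕜, StronglyMeasurable b ∧ StronglyMeasurable c ∧ a = b + c ∧
      WeakBound p q.toReal μ (fun x => ∫⁻ y, ‖b (x, y)‖ₑ ^ q.toReal ∂ν) (rectNorm p q μ ν t a) ∧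
      WeakBound p q.toReal ν (fun y => ∫⁻ x, ‖c (x, y)‖ₑ ^ q.toReal ∂μ)
        (rectNorm p q μ ν t a * (t : ℝ≥0∞)⁻¹) := by
  have hr1 := one_le_toReal (q := q) hqp.ne_top
  have hr : 0 < q.toReal := by linarith
  set R := rectNorm p q μ ν t a with hRdef
  have hR' : R * (t : ℝ≥0∞)⁻¹ ≠ ∞ := ENNReal.mul_ne_top hR (by simpa using ht.ne')
  have ham : Measurable fun z => ‖a z‖ₑ ^ q.toReal := ha.enorm.pow_const _
  have hK₁ := ENNReal.rpow_ne_top_of_nonneg hr.le hR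
  have hK₂ := ENNReal.rpow_ne_top_of_nonneg hr.le hR'
  have hβ := mul_alpha_pos (p := p) (q := q) hqp
  set W := (μ.prod ν).withDensity fun z => ‖a z‖ₑ ^ q.toReal with hW
  have : SigmaFinite W := SigmaFinite.withDensity_of_ne_top' fun z =>
    ENNReal.rpow_ne_top_of_nonneg hr.le enorm_ne_top
  have hrect : ∀ E F, MeasurableSet E → MeasurableSet F → μ E < ∞ → ν F < ∞ →
      W (E ×ˢ F) ≤ ((R ^ q.toReal).toNNReal : ℝ≥0∞) * μ E ^ (q.toReal * alpha p q) +
        (((R * (t : ℝ≥0∞)⁻¹) ^ q.toReal).toNNReal : ℝ≥0∞) * ν F ^ (q.toReal * alpha p q) := by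
    intro E F hE hF hEμ hFν
    rw [ENNReal.coe_toNNReal hK₁, ENNReal.coe_toNNReal hK₂]
    have h1 := lintegral_rect_eq_withDensity (μ := μ) (ν := ν) ha q.toReal
      (measurable_const (a := (1 : ℝ≥0∞))) hE hF
    simp only [one_mul, setLIntegral_one] at h1
    rw [hW, ← h1]
    exact (lintegral_rect_le ht hqp ha hE hF hEμ hFν).trans (max_le_add_of_nonneg zero_le zero_le)
  obtain ⟨W₁, W₂, hsum, hbd⟩ :=
    exists_split_of_rect_le hβ (mul_alpha_le_one hqp) _ _ μ ν W hrect
  rw [ENNReal.coe_toNNReal hK₁, ENNReal.coe_toNNReal hK₂] at hbd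
  have hle : W₁ ≤ W := hsum ▸ Measure.le_add_right le_rfl
  have : SigmaFinite W₁ := Measure.sigmaFinite_of_le W hle
  let g := W₁.rnDeriv W
  have hg1 : g ≤ᵐ[W] 1 := Measure.rnDeriv_le_one_of_le hle
  -- Truncation makes `0 ≤ θ ≤ 1` hold everywhere and changes `g` only on a `W`-null set.
  let θ : M × N → ℝ := fun z => (min (g z) 1).toReal
  have hθm : Measurable θ := ((Measure.measurable_rnDeriv W₁ W).min measurable_const).ennreal_toReal
  have hθ0 : ∀ z, 0 ≤ θ z := fun z => ENNReal.toReal_nonneg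
  have hθ1 : ∀ z, θ z ≤ 1 := fun z => by
    have := ENNReal.toReal_mono ENNReal.one_ne_top (min_le_right (g z) 1)
    simpa using this
  have hθg : (fun z => ENNReal.ofReal (θ z)) =ᵐ[W] g := by
    filter_upwards [hg1] with z hz
    have hz' : min (g z) 1 = g z := min_eq_left hz
    simp only [θ, hz']
    exact ENNReal.ofReal_toReal (hz.trans_lt ENNReal.one_lt_top).ne
  have hint : ∀ S, MeasurableSet S → ∫⁻ z in S, ENNReal.ofReal (θ z) ∂W = W₁ S := by
    intro S hS
    rw [setLIntegral_congr_fun_ae hS (hθg.mono fun z hz _ => hz),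
      Measure.setLIntegral_rnDeriv (Measure.absolutelyContinuous_of_le hle)]
  -- Here `q ≥ 1` enters: `s^q ≤ s` on `[0, 1]`.
  have hpow : ∀ (s : ℝ) z, 0 ≤ s → s ≤ 1 →
      ‖(s : 𝕜) * a z‖ₑ ^ q.toReal ≤ ENNReal.ofReal s * ‖a z‖ₑ ^ q.toReal := by
    intro s z h0 h1
    rw [enorm_mul, ENNReal.mul_rpow_of_nonneg _ _ hr.le]
    gcongr
    rw [← ofReal_norm, RCLike.norm_ofReal, abs_of_nonneg h0]
    refine ENNReal.rpow_le_self_of_le_one ?_ hr1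
    simpa using h1
  let b : M × N → 𝕜 := fun z => (θ z : 𝕜) * a z
  let c : M × N → 𝕜 := fun z => ((1 - θ z : ℝ) : 𝕜) * a z
  have hb : StronglyMeasurable b :=
    (RCLike.continuous_ofReal.comp_stronglyMeasurable hθm.stronglyMeasurable).mul ha
  have hc : StronglyMeasurable c :=
    (RCLike.continuous_ofReal.comp_stronglyMeasurable
      (measurable_const.sub hθm).stronglyMeasurable).mul ha
  refine ⟨b, c, hb, hc, ?_, ?_, ?_⟩
  · funext z
    simp only [Pi.add_apply, b, c, ← add_mul, ← RCLike.ofReal_add]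
    simp
  · have hbm : Measurable fun z => ‖b z‖ₑ ^ q.toReal := hb.enorm.pow_const _
    refine weakBound_of_setLIntegral_le hqp hbm.lintegral_prod_right' hR fun E hE hEμ => ?_
    refine setLIntegral_le_of_rect hbm fun F hF hFν => ?_
    refine le_trans ?_ (hbd E F hE hF hEμ hFν).1
    rw [← hint _ (hE.prod hF), hW, ← lintegral_rect_eq_withDensity ha _ hθm.ennreal_ofReal hE hF]
    exact lintegral_mono fun x => lintegral_mono fun y => hpow _ _ (hθ0 _) (hθ1 _)
  · have hcm : Measurable fun z => ‖c z‖ₑ ^ q.toReal := hc.enorm.pow_const _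
    refine weakBound_of_setLIntegral_le hqp hcm.lintegral_prod_left' hR' fun F hF hFν => ?_
    refine setLIntegral_le_of_rect (f := fun z => ‖c z.swap‖ₑ ^ q.toReal)
      (hcm.comp measurable_swap) fun E hE hEμ => ?_
    refine le_trans ?_ (hbd E F hE hF hEμ hFν).2
    have hW₂ : ∫⁻ z in E ×ˢ F, ENNReal.ofReal (1 - θ z) ∂W = W₂ (E ×ˢ F) := by
      have hfin : W₁ (E ×ˢ F) ≠ ∞ := ((hbd E F hE hF hEμ hFν).1.trans_lt (ENNReal.mul_lt_top hK₁.lt_top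
        (ENNReal.rpow_lt_top_of_nonneg hβ.le hEμ.ne))).ne
      refine (ENNReal.add_right_inj hfin).1 ?_
      rw [← Measure.add_apply, hsum, ← hint _ (hE.prod hF),
        ← lintegral_add_left hθm.ennreal_ofReal, ← setLIntegral_one]
      refine lintegral_congr fun z => ?_
      rw [← ENNReal.ofReal_add (hθ0 z) (by linarith [hθ1 z])]
      simp
    rw [← hW₂, hW, ← lintegral_rect_eq_withDensity ha _
      (θ := fun z => ENNReal.ofReal (1 - θ z)) (measurable_const.sub hθm).ennreal_ofReal hE hF]
    have hcm' : Measurable (Function.uncurry fun x y => ‖c (x, y)‖ₑ ^ q.toReal) := hcm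
    have hswap := lintegral_lintegral_swap (μ := μ.restrict E) (ν := ν.restrict F)
      hcm'.aemeasurable
    refine (le_of_eq hswap.symm).trans ?_
    exact lintegral_mono fun x => lintegral_mono fun y =>
      hpow _ _ (by linarith [hθ1 (x, y)]) (by linarith [hθ0 (x, y)])

end

/-! ### Reduction to σ-finite sets: supports, finite cores and tails. -/

section

theorem sigmaFinite_restrict_iUnion {Ω ι : Type*} [MeasurableSpace Ω] [Countable ι]
    {μ : Measure Ω} {S : ι → Set Ω} (hS : ∀ i, MeasurableSet (S i))
    (h : ∀ i, SigmaFinite (μ.restrict (S i))) : SigmaFinite (μ.restrict (⋃ i, S i)) := by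
  let T : Option (ι × ℕ) → Set Ω := fun o =>
    o.elim (⋃ i, S i)ᶜ fun x => S x.1 ∩ spanningSets (μ.restrict (S x.1)) x.2
  have hU : MeasurableSet (⋃ i, S i) := .iUnion hS
  refine Measure.sigmaFinite_of_countable (S := Set.range T) (Set.countable_range T) ?_ ?_
  · rintro _ ⟨o, rfl⟩
    rcases o with _ | ⟨i, n⟩
    · change (μ.restrict (⋃ i, S i)) (⋃ i, S i)ᶜ < ∞
      rw [Measure.restrict_apply hU.compl, Set.compl_inter_self, measure_empty]
      exact ENNReal.zero_lt_top
    · refine (Measure.restrict_apply_le _ _).trans_lt ?_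
      have := measure_spanningSets_lt_top (μ.restrict (S i)) n
      rwa [Measure.restrict_apply (measurableSet_spanningSets _ n), Set.inter_comm] at this
  · refine Set.eq_univ_of_forall fun x => ?_
    by_cases hx : x ∈ ⋃ i, S i
    · obtain ⟨i, hi⟩ := Set.mem_iUnion.1 hx
      obtain ⟨n, hn⟩ := Set.mem_iUnion.1 (show x ∈ ⋃ n, spanningSets (μ.restrict (S i)) n by
        simp [iUnion_spanningSets])
      exact ⟨T (some (i, n)), ⟨_, rfl⟩, hi, hn⟩
    · exact ⟨T none, ⟨_, rfl⟩, hx⟩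

theorem sigmaFinite_restrict_of_lt_top {Ω : Type*} [MeasurableSpace Ω] {μ : Measure Ω} {S : Set Ω}
    (h : μ S < ∞) : SigmaFinite (μ.restrict S) := by
  have : IsFiniteMeasure (μ.restrict S) := ⟨by simpa using h⟩
  infer_instance

theorem sigmaFinite_restrict_union {Ω : Type*} [MeasurableSpace Ω] {μ : Measure Ω} {S T : Set Ω}
    (hS : MeasurableSet S) (hT : MeasurableSet T) (h1 : SigmaFinite (μ.restrict S))
    (h2 : SigmaFinite (μ.restrict T)) : SigmaFinite (μ.restrict (S ∪ T)) := by
  rw [Set.union_eq_iUnion]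
  refine sigmaFinite_restrict_iUnion (fun i => ?_) fun i => ?_ <;> cases i <;> assumption

/-- A set whose subsets of finite measure have bounded measure is, up to a set without subsets of
positive finite measure, of finite measure. -/
theorem exists_finite_core {Ω : Type*} [MeasurableSpace Ω] {μ : Measure Ω} {H : Set Ω}
    (hH : MeasurableSet H) {m : ℝ≥0∞} (hm : m ≠ ∞)
    (h : ∀ E ⊆ H, MeasurableSet E → μ E < ∞ → μ E ≤ m) :
    ∃ G ⊆ H, MeasurableSet G ∧ μ G < ∞ ∧
      ∀ E, MeasurableSet E → μ E < ∞ → μ (E ∩ (H \ G)) = 0 := by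
  let 𝒮 : Set ℝ≥0∞ := {v | ∃ E ⊆ H, MeasurableSet E ∧ μ E < ∞ ∧ μ E = v}
  have hne : 𝒮.Nonempty := ⟨0, ∅, Set.empty_subset _, .empty, by simp, by simp⟩
  obtain ⟨u, -, hu, huS⟩ := exists_seq_tendsto_sSup hne (OrderTop.bddAbove 𝒮)
  choose E hEH hE hEμ hEu using huS
  have hacc : ∀ n, μ (Set.accumulate E n) ≤ m := by
    intro n
    refine h _ (Set.iUnion₂_subset fun i _ => hEH i) ?_ ?_
    · exact .biUnion (Set.to_countable _) fun i _ => hE i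
    · exact measure_biUnion_lt_top (Set.finite_Iic n) fun i _ => hEμ i
  have hG : μ (⋃ n, E n) ≤ m := by
    rw [← Set.iUnion_accumulate, Set.monotone_accumulate.measure_iUnion]
    exact iSup_le hacc
  have hGT : μ (⋃ n, E n) < ∞ := hG.trans_lt hm.lt_top
  have mG : MeasurableSet (⋃ n, E n) := .iUnion hE
  -- The union attains the supremum of the finite measures, so what is left contains no further set
  -- of positive finite measure.
  have hsup : sSup 𝒮 ≤ μ (⋃ n, E n) :=
    le_of_tendsto hu (.of_forall fun n => (hEu n) ▸ measure_mono (Set.subset_iUnion E n))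
  refine ⟨⋃ n, E n, Set.iUnion_subset hEH, mG, hGT, fun A hA hAμ => ?_⟩
  set A' := A ∩ (H \ ⋃ n, E n)
  have mA' : MeasurableSet A' := hA.inter (hH.diff mG)
  have hd : Disjoint (⋃ n, E n) A' := Set.disjoint_left.2 fun x h1 h2 => h2.2.2 h1
  have hA'μ : μ A' < ∞ := (measure_mono Set.inter_subset_left).trans_lt hAμ
  have h1 : μ ((⋃ n, E n) ∪ A') ≤ sSup 𝒮 := by
    refine le_sSup ⟨_, Set.union_subset (Set.iUnion_subset hEH) fun x hx => hx.2.1, mG.union mA',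
      ?_, rfl⟩
    exact (measure_union_le _ _).trans_lt (ENNReal.add_lt_top.2 ⟨hGT, hA'μ⟩)
  rw [measure_union hd mA'] at h1
  have h2 : μ (⋃ n, E n) + μ A' ≤ μ (⋃ n, E n) + 0 := by
    rw [add_zero]; exact h1.trans hsup
  exact le_antisymm ((ENNReal.add_le_add_iff_left hGT.ne).1 h2) zero_le

variable {M N 𝕜 : Type*} [MeasurableSpace M] [MeasurableSpace N] [RCLike 𝕜]

/-- A strongly measurable function is a pointwise limit of simple functions, which have countably
many values in all. Each value is an `L^q` class with σ-finite support, and the union of these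
supports carries the limit. -/
theorem exists_sigmaFinite_strip {q : ℝ≥0∞} [Fact (1 ≤ q)] (hq : q ≠ ∞) {μ : Measure M}
    {ν : Measure N} {f : M → Lp 𝕜 q ν} (hf : AEStronglyMeasurable f μ) :
    ∃ N₀ : Set N, MeasurableSet N₀ ∧ SigmaFinite (ν.restrict N₀) ∧
      ∀ᵐ x ∂μ, ∀ᵐ y ∂ν, y ∉ N₀ → f x y = 0 := by
  have hq0 : q ≠ 0 := (zero_lt_one.trans_le Fact.out).ne'
  obtain ⟨f', hf', hff'⟩ := hf
  have hsupp : ∀ g : Lp 𝕜 q ν, ∃ S : Set N, MeasurableSet S ∧ SigmaFinite (ν.restrict S) ∧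
      ∀ y ∉ S, g y = 0 := by
    intro g
    obtain ⟨S, hS, h0, hσ⟩ := (Lp.finStronglyMeasurable g hq0 hq).exists_set_sigmaFinite
    exact ⟨S, hS, hσ, h0⟩
  choose S hS hσ h0 using hsupp
  let ι := Σ n : ℕ, (hf'.approx n).range
  let N₀ : Set N := ⋃ i : ι, S i.2.1
  have hN₀ : MeasurableSet N₀ := .iUnion fun i => hS _
  refine ⟨N₀, hN₀, sigmaFinite_restrict_iUnion (fun i => hS _) fun i => hσ _, ?_⟩
  have key : ∀ x, eLpNorm (f' x) q (ν.restrict N₀ᶜ) = 0 := by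
    intro x
    have hlim := hf'.tendsto_approx x
    rw [tendsto_iff_edist_tendsto_0] at hlim
    refine le_antisymm (ge_of_tendsto hlim (.of_forall fun n => ?_)) zero_le
    have hz : (hf'.approx n x : N → 𝕜) =ᵐ[ν.restrict N₀ᶜ] 0 := by
      filter_upwards [ae_restrict_mem hN₀.compl] with y hy
      refine h0 _ y fun hy' => hy ?_
      exact Set.mem_iUnion.2 ⟨⟨n, ⟨hf'.approx n x, SimpleFunc.mem_range_self _ x⟩⟩, hy'⟩
    calc eLpNorm (f' x) q (ν.restrict N₀ᶜ)
        = eLpNorm (⇑(hf'.approx n x) - ⇑(f' x)) q (ν.restrict N₀ᶜ) := by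
          rw [← eLpNorm_neg]
          refine eLpNorm_congr_ae ?_
          filter_upwards [hz] with y hy
          simp [hy]
      _ ≤ eLpNorm (⇑(hf'.approx n x) - ⇑(f' x)) q ν :=
          eLpNorm_mono_measure _ Measure.restrict_le_self
      _ = edist (hf'.approx n x) (f' x) := (Lp.edist_def _ _).symm
  filter_upwards [hff'] with x hx
  rw [hx]
  have h1 := (eLpNorm_eq_zero_iff ((Lp.aestronglyMeasurable (f' x)).restrict) hq0).1 (key x)
  exact (ae_restrict_iff' hN₀.compl).1 h1

/-- The support is the union of the sets `{‖f‖ > 1/(n+1)}`, of finite measure by the weak-type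
bound. -/
theorem exists_sigmaFinite_support {X : Type*} [NormedAddCommGroup X] {p : ℝ≥0∞}
    (hp0 : 0 < p) (hp : p ≠ ∞) {μ : Measure M} {f : M → X} (hf : AEStronglyMeasurable f μ)
    (h : weakLpNorm f p μ < ∞) :
    ∃ M₁ : Set M, MeasurableSet M₁ ∧ SigmaFinite (μ.restrict M₁) ∧ ∀ᵐ x ∂μ, x ∉ M₁ → f x = 0 := by
  rw [weakLpNorm, if_neg hp] at h
  obtain ⟨C, hC, hCT⟩ := sInf_lt_iff.1 h
  have hpr : 0 < p.toReal := ENNReal.toReal_pos hp0.ne' hp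
  obtain ⟨f', hf', hff'⟩ := hf
  let S : ℕ → Set M := fun n => {x | (1 : ℝ) / (n + 1) < ‖f' x‖}
  have mS : ∀ n, MeasurableSet (S n) := fun n =>
    measurableSet_lt measurable_const hf'.norm.measurable
  refine ⟨⋃ n, S n, .iUnion mS, sigmaFinite_restrict_iUnion mS fun n => ?_, ?_⟩
  · refine sigmaFinite_restrict_of_lt_top ?_
    have hn : (0 : ℝ) < 1 / (n + 1) := Nat.one_div_pos_of_nat
    have e : μ (S n) = μ {x | (1 : ℝ) / (n + 1) < ‖f x‖} := by
      refine measure_congr ?_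
      filter_upwards [hff'] with x hx
      refine propext ?_
      change 1 / ((n : ℝ) + 1) < ‖f' x‖ ↔ 1 / ((n : ℝ) + 1) < ‖f x‖
      rw [hx]
    have h1 := (hC _ hn).trans_lt (ENNReal.rpow_lt_top_of_nonneg hpr.le hCT.ne)
    rw [e]
    refine ENNReal.lt_top_of_mul_ne_top_right h1.ne ?_
    simp [ENNReal.rpow_eq_zero_iff, hpr, hpr.le, Nat.cast_add_one_pos]
  · filter_upwards [hff'] with x hx hxS
    rw [hx]
    by_contra h0
    obtain ⟨n, hn⟩ := exists_nat_one_div_lt (norm_pos_iff.2 h0)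
    exact hxS (Set.mem_iUnion.2 ⟨n, hn⟩)

/-- Outside of a σ-finite set and of a locally null set, the sections of a function in the mixed
weak space are controlled by its integrals over rectangles. -/
theorem exists_sigmaFinite_tail {p q : ℝ≥0∞} [Fact (1 ≤ q)] (hqp : q < p) {μ : Measure M}
    {ν : Measure N} {b : M × N → 𝕜} (hb : mixedNorm p q μ ν b < ∞) {N₀ : Set N}
    (hN₀ : MeasurableSet N₀) [SigmaFinite (ν.restrict N₀)] {M₀ : Set M} (hM₀ : MeasurableSet M₀)
    [hM₀σ : SigmaFinite (μ.restrict M₀)] {K₁ K₂ : ℝ≥0∞} (hK₁ : K₁ ≠ ∞) (hK₂ : K₂ ≠ ∞)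
    (h : p = ∞ → ∀ E ⊆ M₀ᶜ, ∀ F ⊆ N₀, MeasurableSet E → MeasurableSet F → μ E < ∞ → ν F < ∞ →
      ∫⁻ x in E, ∫⁻ y in F, ‖b (x, y)‖ₑ ^ q.toReal ∂ν ∂μ ≤ max (K₁ * μ E) (K₂ * ν F)) :
    ∃ M₁ G : Set M, M₀ ⊆ M₁ ∧ MeasurableSet M₁ ∧ SigmaFinite (μ.restrict M₁) ∧
      MeasurableSet G ∧ (∀ E, MeasurableSet E → μ E < ∞ → μ (E ∩ G) = 0) ∧
      ∀ x, x ∉ M₁ → x ∉ G →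
        ∫⁻ y in N₀, ‖b (x, y)‖ₑ ^ q.toReal ∂ν ≤ if p = ∞ then K₁ else 0 := by
  have hr1 := one_le_toReal (q := q) hqp.ne_top
  have hr : 0 < q.toReal := by linarith
  have hbm := stronglyMeasurable_of_mixedNorm_ne_top hb.ne
  by_cases hp : p = ∞
  · simp only [hp, if_true]
    have h := h hp
    let F : ℕ → Set N := fun n => spanningSets (ν.restrict N₀) n ∩ N₀
    have hF : ∀ n, MeasurableSet (F n) := fun n => (measurableSet_spanningSets _ n).inter hN₀
    have hFν : ∀ n, ν (F n) < ∞ := fun n => by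
      rw [← Measure.restrict_apply (measurableSet_spanningSets _ n)]
      exact measure_spanningSets_lt_top _ n
    have hFU : ⋃ n, F n = N₀ := by
      rw [← Set.iUnion_inter, iUnion_spanningSets, Set.univ_inter]
    have hFmono : Monotone F := fun i j hij =>
      Set.inter_subset_inter_left _ (monotone_spanningSets _ hij)
    let g : ℕ → M → ℝ≥0∞ := fun k x => ∫⁻ y in F k, ‖b (x, y)‖ₑ ^ q.toReal ∂ν
    have hg : ∀ k, Measurable (g k) := by
      intro k
      have : IsFiniteMeasure (ν.restrict (F k)) := ⟨by simpa using hFν k⟩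
      exact (hbm.enorm.pow_const _).lintegral_prod_right'
    let ε : ℕ → ℝ≥0∞ := fun n => ((n : ℝ≥0∞) + 1)⁻¹
    have hε0 : ∀ n, ε n ≠ 0 := fun n => by simp [ε]
    have hεT : ∀ n, ε n ≠ ∞ := fun n => by simp [ε]
    -- On a subset `E` of `H i` of finite measure the rectangle bound forces `ε μ(E) ≤ K₂ ν(F)`. So
    -- `H i` has a finite core, which is added to `M₁`, and a locally null rest, which goes into the
    -- exceptional set.
    let H : ℕ × ℕ → Set M := fun i => M₀ᶜ ∩ {x | K₁ + ε i.2 < g i.1 x}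
    have hH : ∀ i, MeasurableSet (H i) := fun i =>
      hM₀.compl.inter (measurableSet_lt measurable_const (hg i.1))
    have hcore : ∀ i, ∃ G ⊆ H i, MeasurableSet G ∧ μ G < ∞ ∧
        ∀ E, MeasurableSet E → μ E < ∞ → μ (E ∩ (H i \ G)) = 0 := by
      intro i
      refine exists_finite_core (hH i) (m := K₂ * ν (F i.1) / ε i.2)
        (ENNReal.div_ne_top (ENNReal.mul_ne_top hK₂ (hFν _).ne) (hε0 _)) fun E hEH hE hEμ => ?_
      have h1 := h E (hEH.trans Set.inter_subset_left) (F i.1) Set.inter_subset_right hE (hF _) hEμ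
        (hFν _)
      have h2 : (K₁ + ε i.2) * μ E ≤ max (K₁ * μ E) (K₂ * ν (F i.1)) := by
        refine le_trans ?_ h1
        rw [← setLIntegral_const]
        exact setLIntegral_mono' hE fun x hx => le_of_lt (hEH hx).2
      rcases le_max_iff.1 h2 with h3 | h3
      · rw [add_mul] at h3
        have h4 : K₁ * μ E + ε i.2 * μ E ≤ K₁ * μ E + 0 := by rwa [add_zero]
        have h5 := (ENNReal.add_le_add_iff_left (ENNReal.mul_ne_top hK₁ hEμ.ne)).1 h4
        have h6 : μ E = 0 := (mul_eq_zero.1 (le_antisymm h5 zero_le)).resolve_left (hε0 _)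
        simp [h6]
      · rw [ENNReal.le_div_iff_mul_le (Or.inl (hε0 _)) (Or.inl (hεT _)), mul_comm]
        refine le_trans ?_ h3
        gcongr
        exact le_add_self
    choose G hGH hG hGμ hGnull using hcore
    refine ⟨M₀ ∪ ⋃ i, G i, ⋃ i, (H i \ G i), Set.subset_union_left, hM₀.union (.iUnion hG),
      sigmaFinite_restrict_union hM₀ (.iUnion hG) hM₀σ (sigmaFinite_restrict_iUnion hG fun i =>
        sigmaFinite_restrict_of_lt_top (hGμ i)), .iUnion fun i => (hH i).diff (hG i),
      fun E hE hEμ => ?_, fun x hx1 hx2 => ?_⟩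
    · rw [Set.inter_iUnion, measure_iUnion_null_iff]
      exact fun i => hGnull i E hE hEμ
    · have hx0 : x ∉ M₀ := fun hx => hx1 (Or.inl hx)
      have hgx : ∀ k, g k x ≤ K₁ := by
        intro k
        have hkn : ∀ n, g k x ≤ K₁ + ε n := by
          intro n
          by_contra! hlt
          have hxH : x ∈ H (k, n) := ⟨hx0, hlt⟩
          by_cases hxG : x ∈ G (k, n)
          · exact hx1 (Or.inr (Set.mem_iUnion.2 ⟨_, hxG⟩))
          · exact hx2 (Set.mem_iUnion.2 ⟨_, hxH, hxG⟩)
        have hlim : Filter.Tendsto (fun n => K₁ + ε n) Filter.atTop (nhds (K₁ + 0)) := by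
          refine tendsto_const_nhds.add ?_
          have := (Filter.tendsto_add_atTop_iff_nat 1).2 ENNReal.tendsto_inv_nat_nhds_zero
          simpa [ε] using this
        rw [add_zero] at hlim
        exact ge_of_tendsto' hlim hkn
      rw [← hFU, setLIntegral_iUnion_of_directed _ hFmono.directed_le]
      exact iSup_le hgx
  · simp only [hp, if_false]
    obtain ⟨f, hf⟩ := iInf_lt_iff.1 hb
    obtain ⟨hfm, hf⟩ := iInf_lt_iff.1 hf
    obtain ⟨hk, hf⟩ := iInf_lt_iff.1 hf
    obtain ⟨M₂, hM₂, hσ, h0⟩ := exists_sigmaFinite_support (pos_of_gt hqp) hp hfm hf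
    have hae : ∀ᵐ x ∂μ, x ∉ M₂ → ∫⁻ y in N₀, ‖b (x, y)‖ₑ ^ q.toReal ∂ν ≤ 0 := by
      filter_upwards [h0, hk.2] with x h1 h2 hx
      refine (setLIntegral_le_lintegral _ _).trans ?_
      rw [← enorm_rpow_eq_lintegral_of_ae_eq hqp.ne_top h2, h1 hx]
      simp [hr]
    refine ⟨M₀ ∪ M₂, toMeasurable μ {x | ¬(x ∉ M₂ → ∫⁻ y in N₀, ‖b (x, y)‖ₑ ^ q.toReal ∂ν ≤ 0)},
      Set.subset_union_left, hM₀.union hM₂, sigmaFinite_restrict_union hM₀ hM₂ hM₀σ hσ,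
      measurableSet_toMeasurable _ _, fun E _ _ => ?_, fun x hx1 hx2 => ?_⟩
    · refine measure_mono_null Set.inter_subset_right ?_
      rw [measure_toMeasurable]
      exact hae
    · by_contra hx
      exact hx2 (subset_toMeasurable _ _ fun h => hx (h fun hx => hx1 (Or.inr hx)))

end

/-! ### Gluing the pieces and the upper bound on the whole sum. -/

section

variable {M N 𝕜 : Type*} [MeasurableSpace M] [MeasurableSpace N] [RCLike 𝕜]

/-- The two pieces live over disjoint sets of `x`, so their weak bounds do not add. Outside `M₁` the
sections vanish if `p < ∞` and are bounded by `D` if `p = ∞`. -/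
theorem mixedNorm_glue_le {p q : ℝ≥0∞} [Fact (1 ≤ q)] (hqp : q < p) {μ : Measure M}
    {ν : Measure N} {M₁ G : Set M} {N₀ N₁ : Set N} (hM₁ : MeasurableSet M₁)
    (hG : MeasurableSet G) (hN₀ : MeasurableSet N₀) (hN₁ : MeasurableSet N₁) (hN : N₀ ⊆ N₁)
    [SigmaFinite (ν.restrict N₁)] {b₁ b₀ : M × N → 𝕜} (hb₁ : StronglyMeasurable b₁)
    (hb₀ : StronglyMeasurable b₀) {D : ℝ≥0∞} (hD : D ≠ ∞)
    (h₁ : WeakBound p q.toReal (μ.restrict M₁)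
      (fun x => ∫⁻ y, ‖b₁ (x, y)‖ₑ ^ q.toReal ∂(ν.restrict N₁)) D)
    (h₀ : ∀ x, x ∉ M₁ → x ∉ G →
      ∫⁻ y in N₀, ‖b₀ (x, y)‖ₑ ^ q.toReal ∂ν ≤ if p = ∞ then D ^ q.toReal else 0) :
    mixedNorm p q μ ν ((M₁ ×ˢ N₁).indicator b₁ + ((M₁ ∪ G)ᶜ ×ˢ N₀).indicator b₀) ≤ D := by
  have hr1 := one_le_toReal (q := q) hqp.ne_top
  have hr : 0 < q.toReal := by linarith
  set b := (M₁ ×ˢ N₁).indicator b₁ + ((M₁ ∪ G)ᶜ ×ˢ N₀).indicator b₀ with hb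
  have hbm : StronglyMeasurable b := (hb₁.indicator (hM₁.prod hN₁)).add
    (hb₀.indicator ((hM₁.union hG).compl.prod hN₀))
  have hbN : ∀ x y, y ∉ N₁ → b (x, y) = 0 := by
    intro x y hy
    have h1 : (x, y) ∉ M₁ ×ˢ N₁ := fun h => hy h.2
    have h2 : (x, y) ∉ (M₁ ∪ G)ᶜ ×ˢ N₀ := fun h => hy (hN h.2)
    simp only [hb, Pi.add_apply, Set.indicator_of_notMem h1, Set.indicator_of_notMem h2, add_zero]
  have hin : ∀ x ∈ M₁, ∫⁻ y, ‖b (x, y)‖ₑ ^ q.toReal ∂ν =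
      ∫⁻ y, ‖b₁ (x, y)‖ₑ ^ q.toReal ∂(ν.restrict N₁) := by
    intro x hx
    rw [← lintegral_indicator hN₁]
    refine lintegral_congr fun y => ?_
    have h2 : (x, y) ∉ (M₁ ∪ G)ᶜ ×ˢ N₀ := fun h => h.1 (Or.inl hx)
    by_cases hy : y ∈ N₁
    · rw [Set.indicator_of_mem hy]
      simp only [hb, Pi.add_apply, Set.indicator_of_notMem h2, add_zero,
        Set.indicator_of_mem (show (x, y) ∈ M₁ ×ˢ N₁ from ⟨hx, hy⟩)]
    · rw [Set.indicator_of_notMem hy, hbN x y hy]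
      simp [hr]
  have hout : ∀ x ∉ M₁, ∫⁻ y, ‖b (x, y)‖ₑ ^ q.toReal ∂ν ≤ if p = ∞ then D ^ q.toReal else 0 := by
    intro x hx
    by_cases hxG : x ∈ G
    · refine le_trans (le_of_eq ?_) zero_le
      rw [← lintegral_zero (μ := ν)]
      refine lintegral_congr fun y => ?_
      have h1 : (x, y) ∉ M₁ ×ˢ N₁ := fun h => hx h.1
      have h2 : (x, y) ∉ (M₁ ∪ G)ᶜ ×ˢ N₀ := fun h => h.1 (Or.inr hxG)
      simp only [hb, Pi.add_apply, Set.indicator_of_notMem h1, Set.indicator_of_notMem h2,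
        add_zero, enorm_zero, ENNReal.zero_rpow_of_pos hr]
    · refine le_trans (le_of_eq ?_) (h₀ x hx hxG)
      rw [← lintegral_indicator hN₀]
      refine lintegral_congr fun y => ?_
      have h1 : (x, y) ∉ M₁ ×ˢ N₁ := fun h => hx h.1
      by_cases hy : y ∈ N₀
      · rw [Set.indicator_of_mem hy]
        simp only [hb, Pi.add_apply, Set.indicator_of_notMem h1, zero_add,
          Set.indicator_of_mem (show (x, y) ∈ (M₁ ∪ G)ᶜ ×ˢ N₀ from
            ⟨fun h => h.elim hx hxG, hy⟩)]
      · have h2 : (x, y) ∉ (M₁ ∪ G)ᶜ ×ˢ N₀ := fun h => hy h.2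
        rw [Set.indicator_of_notMem hy]
        simp only [hb, Pi.add_apply, Set.indicator_of_notMem h1, Set.indicator_of_notMem h2,
        add_zero, enorm_zero, ENNReal.zero_rpow_of_pos hr]
  refine mixedNorm_le_of_weakBound hqp.ne_top hbm hN₁ hbN ⟨?_, fun hp => ?_, fun hp σ hσ => ?_⟩
  · filter_upwards [(ae_restrict_iff' hM₁).1 h₁.1] with x hx
    by_cases hxM : x ∈ M₁
    · rw [hin x hxM]; exact hx hxM
    · refine (hout x hxM).trans_lt ?_
      split_ifs
      · exact ENNReal.rpow_lt_top_of_nonneg hr.le hD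
      · exact ENNReal.zero_lt_top
  · filter_upwards [(ae_restrict_iff' hM₁).1 (h₁.2.1 hp)] with x hx
    by_cases hxM : x ∈ M₁
    · rw [hin x hxM]; exact hx hxM
    · simpa [hp] using hout x hxM
  · refine le_trans ?_ (h₁.2.2 hp σ hσ)
    refine mul_le_mul_right (le_trans (measure_mono ?_) (Measure.le_restrict_apply _ _)) _
    intro x hx
    have hx' : ENNReal.ofReal σ ^ q.toReal < ∫⁻ y, ‖b (x, y)‖ₑ ^ q.toReal ∂ν := hx
    by_cases hxM : x ∈ M₁
    · refine ⟨?_, hxM⟩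
      rw [hin x hxM] at hx'
      exact hx'
    · have := hx'.trans_le (hout x hxM)
      simp [hp] at this

theorem ae_rect_of_ae_ae {μ : Measure M} {ν : Measure N} {b : M × N → 𝕜}
    (hb : StronglyMeasurable b) {N₀ : Set N} (hN₀ : MeasurableSet N₀)
    (h : ∀ᵐ x ∂μ, ∀ᵐ y ∂ν, y ∉ N₀ → b (x, y) = 0) {E : Set M} {F : Set N}
    (hFν : ν F < ∞) :
    ∀ᵐ z ∂((μ.restrict E).prod (ν.restrict F)), z.2 ∉ N₀ → b z = 0 := by
  have : IsFiniteMeasure (ν.restrict F) := ⟨by simpa using hFν⟩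
  have hm : MeasurableSet {z : M × N | z.2 ∉ N₀ → b z = 0} := by
    have e : {z : M × N | z.2 ∉ N₀ → b z = 0} = Prod.snd ⁻¹' N₀ ∪ b ⁻¹' {0} := by
      ext z
      simp only [Set.mem_ofPred_eq, Set.mem_union, Set.mem_preimage, Set.mem_singleton_iff]
      tauto
    rw [e]
    exact (measurable_snd hN₀).union (hb.measurable (measurableSet_singleton 0))
  rw [Measure.ae_prod_iff_ae_ae hm]
  exact ae_restrict_of_ae (h.mono fun x hx => ae_restrict_of_ae hx)

theorem rectNorm_congr {p q : ℝ≥0∞} {μ : Measure M} {ν : Measure N} {t : ℝ≥0}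
    {a a' : M × N → 𝕜} (h : LocallyAEEq μ ν a a') :
    rectNorm p q μ ν t a = rectNorm p q μ ν t a' := by
  unfold rectNorm
  refine iSup_congr fun E => iSup_congr fun F => iSup_congr fun hE => iSup_congr fun hF =>
    iSup_congr fun _ => iSup_congr fun hEμ => iSup_congr fun _ => iSup_congr fun hFν => ?_
  rw [eLpNorm_congr_ae (h E F hE hF hEμ hFν)]

theorem rectNorm_restrict_le {p q : ℝ≥0∞} {μ : Measure M} {ν : Measure N} {t : ℝ≥0}
    {a : M × N → 𝕜} {M₁ : Set M} {N₁ : Set N} (hM₁ : MeasurableSet M₁) (hN₁ : MeasurableSet N₁) :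
    rectNorm p q (μ.restrict M₁) (ν.restrict N₁) t a ≤ rectNorm p q μ ν t a := by
  refine iSup_le fun E => iSup_le fun F => iSup_le fun hE => iSup_le fun hF => ?_
  rw [Measure.restrict_apply hE, Measure.restrict_apply hF, Measure.restrict_restrict hE,
    Measure.restrict_restrict hF]
  exact le_iSup_of_le (E ∩ M₁) <| le_iSup_of_le (F ∩ N₁) <| le_iSup_of_le (hE.inter hM₁) <|
    le_iSup_of_le (hF.inter hN₁) le_rfl

theorem mul_mul_inv_add_self {t : ℝ≥0} (ht : 0 < t) (R : ℝ≥0∞) :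
    R + t * (R * (t : ℝ≥0∞)⁻¹) = 2 * R := by
  have ht0 : (t : ℝ≥0∞) ≠ 0 := by simpa using ht.ne'
  rw [mul_left_comm, ENNReal.mul_inv_cancel ht0 ENNReal.coe_ne_top, mul_one, two_mul]

theorem kFunctional_le_of_sigmaFinite {p q : ℝ≥0∞} [Fact (1 ≤ q)] (hqp : q < p)
    (μ : Measure M) (ν : Measure N) [SigmaFinite μ] [SigmaFinite ν] {t : ℝ≥0} (ht : 0 < t)
    {a : M × N → 𝕜} (ha : AEStronglyMeasurable a (μ.prod ν)) :
    kFunctional p q μ ν t a ≤ 2 * rectNorm p q μ ν t a := by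
  obtain ⟨a', ha', haa'⟩ := ha
  have hloc : LocallyAEEq μ ν a a' := by
    intro E F _ _ _ _
    rw [Measure.prod_restrict]
    exact ae_restrict_of_ae haa'
  rw [rectNorm_congr hloc]
  by_cases hR : rectNorm p q μ ν t a' = ∞
  · rw [hR]; simp
  obtain ⟨b, c, hb, hc, hbc, hbw, hcw⟩ := exists_decomposition_of_sigmaFinite hqp μ ν ht ha' hR
  rw [← mul_mul_inv_add_self ht]
  have hσν : SigmaFinite (ν.restrict Set.univ) := inferInstance
  have hσμ : SigmaFinite (μ.restrict Set.univ) := inferInstance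
  refine iInf_le_of_le b <| iInf_le_of_le c <| iInf_le_of_le (hbc ▸ hloc) ?_
  gcongr
  · exact mixedNorm_le_of_weakBound hqp.ne_top hb .univ (fun x y hy => absurd trivial hy) hbw
  · exact mixedNorm_le_of_weakBound hqp.ne_top (hc.comp_measurable measurable_swap) .univ
      (fun x y hy => absurd trivial hy) hcw

/-- Inside `M₁ × N₁` the new splitting is used. Outside it, a part of `b₀` or `c₀` that is dropped
would have to lie off its strip, where it is zero. -/
theorem glue_eq {M N 𝕜 : Type*} [RCLike 𝕜] {a b₁ c₁ b₀ c₀ : M × N → 𝕜} {M₀ M₁ G : Set M}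
    {N₀ N₁ H : Set N} (hM : M₀ ⊆ M₁) (hN : N₀ ⊆ N₁) {z : M × N} (h₁ : a z = b₁ z + c₁ z)
    (h₀ : a z = b₀ z + c₀ z) (hb : z.2 ∉ N₀ → b₀ z = 0) (hc : z.1 ∉ M₀ → c₀ z = 0)
    (hG : z.1 ∉ G) (hH : z.2 ∉ H) :
    a z = ((M₁ ×ˢ N₁).indicator b₁ + ((M₁ ∪ G)ᶜ ×ˢ N₀).indicator b₀) z +
      ((N₁ ×ˢ M₁).indicator (c₁ ∘ Prod.swap) +
        ((N₁ ∪ H)ᶜ ×ˢ M₀).indicator (c₀ ∘ Prod.swap)) z.swap := by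
  classical
  obtain ⟨x, y⟩ := z
  have i₁ : (x, y) ∈ M₁ ×ˢ N₁ ↔ x ∈ M₁ ∧ y ∈ N₁ := Iff.rfl
  have i₂ : (x, y) ∈ (M₁ ∪ G)ᶜ ×ˢ N₀ ↔ x ∉ M₁ ∧ y ∈ N₀ :=
    ⟨fun h => ⟨fun hx => h.1 (Or.inl hx), h.2⟩, fun h => ⟨fun hx => hx.elim h.1 hG, h.2⟩⟩
  have i₃ : (y, x) ∈ N₁ ×ˢ M₁ ↔ x ∈ M₁ ∧ y ∈ N₁ := and_comm
  have i₄ : (y, x) ∈ (N₁ ∪ H)ᶜ ×ˢ M₀ ↔ y ∉ N₁ ∧ x ∈ M₀ :=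
    ⟨fun h => ⟨fun hx => h.1 (Or.inl hx), h.2⟩, fun h => ⟨fun hx => hx.elim h.1 hH, h.2⟩⟩
  have hx := @hM x
  have hy := @hN y
  simp only [Pi.add_apply, Function.comp_apply, Prod.swap_prod_mk, Set.indicator_apply, i₁, i₂,
    i₃, i₄]
  dsimp only at hb hc
  by_cases h : x ∈ M₁ ∧ y ∈ N₁
  · simp [h.1, h.2, h₁]
  · rw [h₀]
    clear h₀ h₁ i₁ i₂ i₃ i₄
    by_cases x₁ : x ∈ M₁ <;> by_cases y₁ : y ∈ N₁ <;> by_cases x₀ : x ∈ M₀ <;>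
      by_cases y₀ : y ∈ N₀ <;> simp_all

theorem exists_sigmaFinite_strip_of_mixedNorm {p q : ℝ≥0∞} [Fact (1 ≤ q)] (hq : q ≠ ∞)
    {μ : Measure M} {ν : Measure N} {b : M × N → 𝕜} (hb : mixedNorm p q μ ν b < ∞) :
    ∃ N₀ : Set N, MeasurableSet N₀ ∧ SigmaFinite (ν.restrict N₀) ∧
      ∀ᵐ x ∂μ, ∀ᵐ y ∂ν, y ∉ N₀ → b (x, y) = 0 := by
  obtain ⟨f, hf⟩ := iInf_lt_iff.1 hb
  obtain ⟨hfm, hf⟩ := iInf_lt_iff.1 hf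
  obtain ⟨hk, hf⟩ := iInf_lt_iff.1 hf
  obtain ⟨N₀, hN₀, hσ, h0⟩ := exists_sigmaFinite_strip hq hfm
  refine ⟨N₀, hN₀, hσ, ?_⟩
  filter_upwards [h0, hk.2] with x h1 h2
  filter_upwards [h1, h2] with y h3 h4 hy
  rw [← h4, h3 hy]

theorem kFunctional_le_of_memSum {p q : ℝ≥0∞} [Fact (1 ≤ q)] (hqp : q < p)
    (μ : Measure M) (ν : Measure N) {t : ℝ≥0} (ht : 0 < t)
    {a : M × N → 𝕜} (ha : MemSum p q μ ν a) :
    kFunctional p q μ ν t a ≤ 2 * rectNorm p q μ ν t a := by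
  obtain ⟨b₀, c₀, hloc, hb, hc⟩ := ha
  have hr1 := one_le_toReal (q := q) hqp.ne_top
  have hr : 0 < q.toReal := by linarith
  have hb₀ := stronglyMeasurable_of_mixedNorm_ne_top hb.ne
  have hc₀' := stronglyMeasurable_of_mixedNorm_ne_top hc.ne
  have hc₀ : StronglyMeasurable c₀ := by
    have := hc₀'.comp_measurable measurable_swap
    simpa [Function.comp_assoc] using this
  set a' := b₀ + c₀ with ha'
  have ha'm : StronglyMeasurable a' := hb₀.add hc₀
  rw [rectNorm_congr hloc]
  set R := rectNorm p q μ ν t a' with hRdef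
  by_cases hR : R = ∞
  · rw [hR]; simp
  have hR' : R * (t : ℝ≥0∞)⁻¹ ≠ ∞ := ENNReal.mul_ne_top hR (by simpa using ht.ne')
  have hK₁ := ENNReal.rpow_ne_top_of_nonneg hr.le hR
  have hK₂ := ENNReal.rpow_ne_top_of_nonneg hr.le hR'
  obtain ⟨N₀, hN₀, hσN₀, hbN₀⟩ := exists_sigmaFinite_strip_of_mixedNorm hqp.ne_top hb
  obtain ⟨M₀, hM₀, hσM₀, hcM₀⟩ := exists_sigmaFinite_strip_of_mixedNorm hqp.ne_top hc
  have aeb : ∀ (E : Set M) (F : Set N), ν F < ∞ →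
      ∀ᵐ z ∂((μ.restrict E).prod (ν.restrict F)), z.2 ∉ N₀ → b₀ z = 0 := fun E F hF =>
    ae_rect_of_ae_ae hb₀ hN₀ hbN₀ hF
  have aec : ∀ (E : Set M) (F : Set N), μ E < ∞ → ν F < ∞ →
      ∀ᵐ z ∂((μ.restrict E).prod (ν.restrict F)), z.1 ∉ M₀ → c₀ z = 0 := by
    intro E F hE hF
    have : IsFiniteMeasure (ν.restrict F) := ⟨by simpa using hF⟩
    have : IsFiniteMeasure (μ.restrict E) := ⟨by simpa using hE⟩
    have h1 := ae_rect_of_ae_ae (E := F) hc₀' hM₀ hcM₀ hE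
    exact (Measure.measurePreserving_swap (μ := μ.restrict E)
      (ν := ν.restrict F)).quasiMeasurePreserving.ae h1
  -- Off `M₀` the term `c₀` vanishes almost everywhere on rectangles, so the rectangle bounds for
  -- `a'` are bounds for `b₀` alone.
  have tailb : p = ∞ → ∀ E ⊆ M₀ᶜ, ∀ F ⊆ N₀, MeasurableSet E → MeasurableSet F → μ E < ∞ →
      ν F < ∞ → ∫⁻ x in E, ∫⁻ y in F, ‖b₀ (x, y)‖ₑ ^ q.toReal ∂ν ∂μ ≤
        max (R ^ q.toReal * μ E) ((R * (t : ℝ≥0∞)⁻¹) ^ q.toReal * ν F) := by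
    intro hp E hEM F _ hE hF hEμ hFν
    have : IsFiniteMeasure (ν.restrict F) := ⟨by simpa using hFν⟩
    have h1 := lintegral_rect_le ht hqp ha'm hE hF hEμ hFν
    have hβ : q.toReal * alpha p q = 1 := by rw [mul_alpha hqp, hp]; simp
    rw [hβ, ENNReal.rpow_one, ENNReal.rpow_one] at h1
    refine le_trans (le_of_eq ?_) h1
    rw [← lintegral_prod _ (hb₀.enorm.pow_const _).aemeasurable,
      ← lintegral_prod _ (ha'm.enorm.pow_const _).aemeasurable]
    refine lintegral_congr_ae ?_
    filter_upwards [aec E F hEμ hFν, Measure.quasiMeasurePreserving_fst.ae (ae_restrict_mem hE)]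
      with z h2 h3
    rw [ha', Pi.add_apply, h2 (hEM h3), add_zero]
  have tailc : p = ∞ → ∀ F ⊆ N₀ᶜ, ∀ E ⊆ M₀, MeasurableSet F → MeasurableSet E → ν F < ∞ →
      μ E < ∞ → ∫⁻ y in F, ∫⁻ x in E, ‖(c₀ ∘ Prod.swap) (y, x)‖ₑ ^ q.toReal ∂μ ∂ν ≤
        max ((R * (t : ℝ≥0∞)⁻¹) ^ q.toReal * ν F) (R ^ q.toReal * μ E) := by
    intro hp F hFN E _ hF hE hFν hEμ
    have : IsFiniteMeasure (ν.restrict F) := ⟨by simpa using hFν⟩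
    have : IsFiniteMeasure (μ.restrict E) := ⟨by simpa using hEμ⟩
    have h1 := lintegral_rect_le ht hqp ha'm hE hF hEμ hFν
    have hβ : q.toReal * alpha p q = 1 := by rw [mul_alpha hqp, hp]; simp
    rw [hβ, ENNReal.rpow_one, ENNReal.rpow_one, max_comm] at h1
    refine le_trans (le_of_eq ?_) h1
    have h2 := lintegral_prod_symm (μ := μ.restrict E) (ν := ν.restrict F)
      (fun z => ‖c₀ z‖ₑ ^ q.toReal) (hc₀.enorm.pow_const _).aemeasurable
    refine h2.symm.trans ?_
    rw [← lintegral_prod _ (ha'm.enorm.pow_const _).aemeasurable]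
    refine lintegral_congr_ae ?_
    filter_upwards [aeb E F hFν, Measure.quasiMeasurePreserving_snd.ae (ae_restrict_mem hF)]
      with z h2 h3
    rw [ha', Pi.add_apply, h2 (hFN h3), zero_add]
  obtain ⟨M₁, G, hM₀₁, hM₁, hσM₁, hG, hGnull, hGb⟩ :=
    exists_sigmaFinite_tail hqp hb hN₀ hM₀ hK₁ hK₂ tailb
  obtain ⟨N₁, H, hN₀₁, hN₁, hσN₁, hH, hHnull, hHc⟩ :=
    exists_sigmaFinite_tail hqp hc hM₀ hN₀ hK₂ hK₁ tailc
  have hle : rectNorm p q (μ.restrict M₁) (ν.restrict N₁) t a' ≤ R := rectNorm_restrict_le hM₁ hN₁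
  obtain ⟨b₁, c₁, hb₁, hc₁, hbc, hbw, hcw⟩ := exists_decomposition_of_sigmaFinite hqp
    (μ.restrict M₁) (ν.restrict N₁) ht ha'm (ne_top_of_le_ne_top hR hle)
  have hbw' := hbw.mono_right hr.le hle
  have hcw' := hcw.mono_right hr.le (mul_le_mul_left hle _)
  have hbn := mixedNorm_glue_le hqp hM₁ hG hN₀ hN₁ hN₀₁ hb₁ hb₀ hR hbw' hGb
  have hcn := mixedNorm_glue_le hqp hN₁ hH hM₀ hM₁ hM₀₁ (hc₁.comp_measurable measurable_swap)
    hc₀' hR' hcw' hHc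
  set b := (M₁ ×ˢ N₁).indicator b₁ + ((M₁ ∪ G)ᶜ ×ˢ N₀).indicator b₀ with hbdef
  set c := (N₁ ×ˢ M₁).indicator (c₁ ∘ Prod.swap) +
    ((N₁ ∪ H)ᶜ ×ˢ M₀).indicator (c₀ ∘ Prod.swap) with hcdef
  rw [← mul_mul_inv_add_self ht]
  -- Discarding the values over `G` and `H` is allowed, because these sets are null in every set of
  -- finite measure and functions are identified only on such rectangles.
  refine iInf_le_of_le b <| iInf_le_of_le (c ∘ Prod.swap) <| iInf_le_of_le ?_ ?_
  · intro E F hE hF hEμ hFν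
    have : IsFiniteMeasure (ν.restrict F) := ⟨by simpa using hFν⟩
    refine (hloc E F hE hF hEμ hFν).trans ?_
    have hGae : ∀ᵐ x ∂(μ.restrict E), x ∉ G := by
      rw [ae_iff]
      simp only [not_not, Set.ofPred_mem_eq]
      rw [Measure.restrict_apply hG, Set.inter_comm]
      exact hGnull E hE hEμ
    have hHae : ∀ᵐ y ∂(ν.restrict F), y ∉ H := by
      rw [ae_iff]
      simp only [not_not, Set.ofPred_mem_eq]
      rw [Measure.restrict_apply hH, Set.inter_comm]
      exact hHnull F hF hFν
    filter_upwards [aeb E F hFν, aec E F hEμ hFν, Measure.quasiMeasurePreserving_fst.ae hGae,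
      Measure.quasiMeasurePreserving_snd.ae hHae] with z h1 h2 h3 h4
    exact glue_eq hM₀₁ hN₀₁ (congrFun hbc z) rfl h1 h2 h3 h4
  · rw [Function.comp_assoc, Prod.swap_swap_eq, Function.comp_id]
    gcongr

end

end WeakMixed

theorem corollary3p2 {M N 𝕜 : Type*} [MeasurableSpace M] [MeasurableSpace N] [RCLike 𝕜]
    (μ : Measure M) (ν : Measure N) (p q : ℝ≥0∞) [Fact (1 ≤ q)] (hqp : q < p)
    (t : ℝ≥0) (ht : 0 < t) :
    (∀ a : M × N → 𝕜, WeakMixed.MemSum p q μ ν a →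
      WeakMixed.lowerConst p q * WeakMixed.rectNorm p q μ ν t a
          ≤ WeakMixed.kFunctional p q μ ν t a ∧
        WeakMixed.kFunctional p q μ ν t a ≤ 2 * WeakMixed.rectNorm p q μ ν t a) ∧
    (SigmaFinite μ → SigmaFinite ν →
      ∀ a : M × N → 𝕜, AEStronglyMeasurable a (μ.prod ν) →
        WeakMixed.lowerConst p q * WeakMixed.rectNorm p q μ ν t a
            ≤ WeakMixed.kFunctional p q μ ν t a ∧
          WeakMixed.kFunctional p q μ ν t a ≤ 2 * WeakMixed.rectNorm p q μ ν t a) :=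
  ⟨fun a ha => ⟨WeakMixed.lowerConst_mul_rectNorm_le hqp μ ν ht a,
      WeakMixed.kFunctional_le_of_memSum hqp μ ν ht ha⟩,
    fun _ _ a ha => ⟨WeakMixed.lowerConst_mul_rectNorm_le hqp μ ν ht a,
      WeakMixed.kFunctional_le_of_sigmaFinite hqp μ ν ht ha⟩⟩
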